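/- Let $(\Omega,\mathcal F,\mathbb P)$ be a probability space and let $f:\mathbb R^d\to\mathbb R$ be a differentiable function that is bounded from below and whose gradient $\nabla f$ is Lipschitz continuous with some constant $L>0$. Put $\mathrm{crit}(f)=\{x\in\mathbb R^d:\nabla f(x)=0\}$ and suppose that $f$ satisfies the Łojasiewicz inequality at every critical point: for every $x^*\in\mathrm{crit}(f)$ there are $\eta\in(0,\infty]$, a neighborhood $U$ of $x^*$, a constant $C>0$ and an exponent $\theta\in[\tfrac12,1)$ (all of which may depend on $x^*$) such that $$\|\nabla f(x)\|\ge C\,|f(x)-f(x^*)|^{\theta}\quad\text{for all } x\in U \text{ with } 0<|f(x)-f(x^*)|<\eta .$$ Let $\lambda\in[0,1)$, $\nu\ge 0$, and let $(\alpha_k)_{k\ge1}$ be a non-increasing sequence of positive real numbers with $$\sum_{k=1}^\infty\alpha_k=\infty\quad\text{and}\quad \sum_{k=1}^\infty\alpha_k^2\Big(\sum_{i=1}^k\alpha_i\Big)^{2r}<\infty\quad\text{for some } r>\tfrac12 .$$ Let $x^0\in\mathbb R^d$ be deterministic, $x^1=x^0$, and let the random vectors $x^k:\Omega\to\mathbb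 R^d$ be generated by the stochastic gradient method with momentum, $$x^{k+1}=x^k-\alpha_k\big(\nabla f(x^k+\nu(x^k-x^{k-1}))-e^k\big)+\lambda(x^k-x^{k-1}),\qquad k\ge 1,$$ where, with $\mathcal F_k=\sigma(x^0,\dots,x^k)$ and some constant $\sigma$, the random errors $e^k:\Omega\to\mathbb R^d$ satisfy $\mathbb E[e^k\mid\mathcal F_k]=0$ and $\mathbb E[\|e^k\|^2\mid\mathcal F_k]\le\sigma^2$ almost surely for all $k\ge1$. Then, with probability one, either $\lim_{k\to\infty}\|x^k\|=\infty$ or $(x^k)_k$ converges to some (random) point of $\mathrm{crit}(f)$. (No a priori boundedness of the iterates is assumed.) -/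

import Mathlib

open MeasureTheory ProbabilityTheory Filter Topology
open scoped NNReal Gradient

/-- The set `crit f` of critical (stationary) points of `f`. -/
def critSet {d : ℕ} (f : EuclideanSpace ℝ (Fin d) → ℝ) : Set (EuclideanSpace ℝ (Fin d)) :=
  {x | ∇ f x = 0}

/-- `f` is differentiable and bounded from below, and its gradient is Lipschitz continuous with
some parameter `L > 0`. -/
structure SmoothBoundedBelow {d : ℕ} (f : EuclideanSpace ℝ (Fin d) → ℝ) : Prop where
  differentiable : Differentiable ℝ f
  bddBelow : ∃ fbar : ℝ, ∀ x, fbar ≤ f x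
  lipschitz : ∃ L : ℝ≥0, 0 < L ∧ LipschitzWith L (∇ f)

/-- The Łojasiewicz inequality at `xs`, with `η ∈ (0, ∞]`, a neighborhood `U` of `xs`, a constant
`C > 0` and an exponent `θ ∈ [1/2, 1)`, all of which may depend on `xs`. -/
def LojasiewiczAt {d : ℕ} (f : EuclideanSpace ℝ (Fin d) → ℝ)
    (xs : EuclideanSpace ℝ (Fin d)) : Prop :=
  ∃ η : EReal, 0 < η ∧ ∃ U ∈ 𝓝 xs, ∃ C : ℝ, 0 < C ∧ ∃ θ : ℝ, 1 / 2 ≤ θ ∧ θ < 1 ∧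
    ∀ x ∈ U, 0 < |f x - f xs| → ((|f x - f xs| : ℝ) : EReal) < η →
      C * |f x - f xs| ^ θ ≤ ‖∇ f x‖

/-- The process `x` is generated by stochastic gradient descent with momentum, with deterministic
initial points `x 0 = x 1 = x₀`, step sizes `α`, momentum parameters `lam`, `ν` and stochastic
errors `e`. Only `α k` and `e k` with `1 ≤ k` enter. -/
structure IsSGDM {d : ℕ} {Ω : Type*} (f : EuclideanSpace ℝ (Fin d) → ℝ) (α : ℕ → ℝ) (lam ν : ℝ)
    (x₀ : EuclideanSpace ℝ (Fin d)) (e x : ℕ → Ω → EuclideanSpace ℝ (Fin d)) : Prop where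
  init_zero : ∀ ω, x 0 ω = x₀
  init_one : ∀ ω, x 1 ω = x₀
  step : ∀ k, 1 ≤ k → ∀ ω,
    x (k + 1) ω = x k ω
      - α k • (∇ f (x k ω + ν • (x k ω - x (k - 1) ω)) - e k ω)
      + lam • (x k ω - x (k - 1) ω)

/-- With respect to the natural filtration `F k = σ(x 0, …, x k)`, the errors have conditional mean
zero and conditional second moment at most `σ ^ 2`. Square integrability is a consequence of the
latter bound; it is spelled out because `condExp` is `0` on functions that are not integrable. -/
structure NoiseAssumption {d : ℕ} {Ω : Type*} [MeasurableSpace Ω] (μ : Measure Ω)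
    (x : ℕ → Ω → EuclideanSpace ℝ (Fin d)) (hx : ∀ k, StronglyMeasurable (x k))
    (e : ℕ → Ω → EuclideanSpace ℝ (Fin d)) (σ : ℝ) : Prop where
  memLp : ∀ k, 1 ≤ k → MemLp (e k) 2 μ
  condMean : ∀ k, 1 ≤ k → μ[e k | Filtration.natural x hx k] =ᵐ[μ] 0
  condVar : ∀ k, 1 ≤ k →
    μ[fun ω => ‖e k ω‖ ^ 2 | Filtration.natural x hx k] ≤ᵐ[μ] fun _ => σ ^ 2

/-! Single noisy steps need not decrease `f`, so the steps are grouped into blocks whose total step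
size is comparable to a small fixed τ. With v^k = x^k - x^{k-1}, the averaged iterates z^k = x^k +
λ/(1-λ) v^k obey a recursion without momentum, z^{k+1} = z^k - α_k/(1-λ) (g^k - e^k). Over a block
of length T they make one gradient step of length T/(1-λ), up to an error O(T²(‖∇f(z)‖ + ‖v‖) + s),
where s bounds the partial sums of the noise in the block; up to the same error, v shrinks by a
factor 1/4 (`block_estimates`). Hence f(z) + ‖v‖² decreases from block to block up to O(s²)
(`lyapunov_decrease_arith`).

Doob's L² inequality bounds E s_j² by a multiple of the sum of α_k² over block j. There the sum of
all step sizes so far is at least of order j + 1, so the summability hypothesis gives Σ (j+1)^{2r}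
s_j² < ∞ almost surely, with 2r > 1 (`ae_summable_block_noise`).

The rest is deterministic (`inexact_descent_dichotomy`). Adding the tail u_j of the errors makes the
Lyapunov function monotone; its convergence forces ∇f and v to 0. If the norms do not tend to
infinity, there is a cluster point, and it is critical. Raising the Łojasiewicz exponent above
1/(2r) makes u_j^θ summable, and the concavity of t ↦ t^{1-θ} bounds the steps near the cluster
point by a telescoping term plus a summable one. This traps the sequence, so one cluster point
replaces boundedness. Inside a block the iterates stay close to the averaged iterate at its start,
so they share the limit. -/

/-! ### Inexact descent under the Łojasiewicz inequality -/

/-- Near a critical point, the exponent of the Łojasiewicz inequality can be increased beyond any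
prescribed `q < 1`. -/
theorem LojasiewiczAt.exists_exponent_gt {d : ℕ} {f : EuclideanSpace ℝ (Fin d) → ℝ}
    {xs : EuclideanSpace ℝ (Fin d)} (h : LojasiewiczAt f xs) (hf : ContinuousAt f xs)
    {q : ℝ} (hq : q < 1) :
    ∃ θ : ℝ, 1 / 2 ≤ θ ∧ θ < 1 ∧ q < θ ∧ ∃ C : ℝ, 0 < C ∧
      ∀ᶠ x in 𝓝 xs, |f x - f xs| ^ θ ≤ C * ‖∇ f x‖ := by
  obtain ⟨η, hη, U, hU, C, hC, θ, hθ, hθ1, H⟩ := h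
  -- Once |f x - f xs| < 1, a larger exponent only makes the left side smaller; the midpoint of q
  -- and 1 exceeds q.
  refine ⟨max θ ((q + 1) / 2), le_max_of_le_left hθ, max_lt hθ1 (by linarith),
    lt_max_of_lt_right (by linarith), C⁻¹, inv_pos.2 hC, ?_⟩
  have hlim : Tendsto (fun x => |f x - f xs|) (𝓝 xs) (𝓝 0) := by
    have : Tendsto (fun x => |f x - f xs|) (𝓝 xs) (𝓝 |f xs - f xs|) :=
      (hf.sub continuousAt_const).abs
    simpa using this
  have hlimE : Tendsto (fun x => ((|f x - f xs| : ℝ) : EReal)) (𝓝 xs) (𝓝 ((0 : ℝ) : EReal)) :=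
    (continuous_coe_real_ereal.tendsto 0).comp hlim
  have h1 : ∀ᶠ x in 𝓝 xs, |f x - f xs| < 1 := hlim.eventually_lt_const one_pos
  have h2 : ∀ᶠ x in 𝓝 xs, ((|f x - f xs| : ℝ) : EReal) < η :=
    hlimE.eventually_lt_const (by simpa using hη)
  filter_upwards [h1, h2, hU] with x hx1 hx2 hxU
  rcases (abs_nonneg (f x - f xs)).eq_or_lt with h0 | h0
  · rw [← h0, Real.zero_rpow (by linarith [le_max_left θ ((q + 1) / 2)])]
    positivity
  · have h3 := H x hxU h0 hx2
    calc |f x - f xs| ^ max θ ((q + 1) / 2) ≤ |f x - f xs| ^ θ :=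
          Real.rpow_le_rpow_of_exponent_ge h0 hx1.le (le_max_left _ _)
      _ = C⁻¹ * (C * |f x - f xs| ^ θ) := by field_simp
      _ ≤ C⁻¹ * ‖∇ f x‖ := by gcongr

/-- A sequence whose increments near a cluster point are dominated by the decrements of a
nonnegative null sequence converges to that cluster point. -/
theorem tendsto_of_dist_le_sub_of_mapClusterPt {X : Type*} [PseudoMetricSpace X] {Z : ℕ → X}
    {z : X} {P : ℕ → ℝ} (hP0 : ∀ j, 0 ≤ P j) (hP : Tendsto P atTop (𝓝 0))
    (hz : MapClusterPt z atTop Z)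
    (hstep : ∃ U ∈ 𝓝 z, ∀ᶠ j in atTop, Z j ∈ U → dist (Z (j + 1)) (Z j) ≤ P j - P (j + 1)) :
    Tendsto Z atTop (𝓝 z) := by
  obtain ⟨U, hU, hev⟩ := hstep
  obtain ⟨ρ, hρ, hρU⟩ := Metric.mem_nhds_iff.1 hU
  rw [Metric.tendsto_atTop]
  intro ε hε
  have hε' : 0 < min ε ρ := lt_min hε hρ
  obtain ⟨J₀, hJ₀⟩ := eventually_atTop.1 hev
  have hPs : ∀ᶠ j in atTop, P j < min ε ρ / 2 := hP.eventually_lt_const (by linarith)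
  have hfr : ∃ᶠ j in atTop, Z j ∈ Metric.ball z (min ε ρ / 2) :=
    mapClusterPt_iff_frequently.1 hz _ (Metric.ball_mem_nhds _ (by linarith))
  obtain ⟨J, hJz, hJP, hJ⟩ := (hfr.and_eventually (hPs.and (eventually_ge_atTop J₀))).exists
  rw [Metric.mem_ball] at hJz
  -- The potential dist(Z j, z) + P j starts below min ε ρ and does not grow while Z j lies in the
  -- ball of radius ρ; since P ≥ 0, this keeps Z j in that ball.
  have key : ∀ j, J ≤ j → dist (Z j) z + P j ≤ dist (Z J) z + P J := by
    intro j hj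
    induction j, hj using Nat.le_induction with
    | base => exact le_rfl
    | succ j hj ih =>
      have hlt : dist (Z j) z < ρ := by
        have := hP0 j
        have := min_le_right ε ρ
        linarith
      have h1 := hJ₀ j (hJ.trans hj) (hρU hlt)
      have h2 := dist_triangle (Z (j + 1)) (Z j) z
      linarith
  refine ⟨J, fun j hj => ?_⟩
  have := key j hj
  have := hP0 j
  have := min_le_left ε ρ
  linarith

/-- Concavity of `t ↦ t ^ (1 - θ)` turns a sufficient decrease estimate together with a
Łojasiewicz type bound into a bound on the length of a step. -/
theorem le_rpow_sub_rpow_add_of_decrease {θ a b c C E E' : ℝ} (hθ0 : 0 ≤ θ) (hθ1 : θ < 1)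
    (hb : 0 ≤ b) (hc : 0 < c) (hC : 0 < C) (hE : 0 ≤ E) (hE' : 0 ≤ E')
    (hdec : c * a ^ 2 ≤ E - E') (hloj : E ^ θ ≤ C * (a + b)) :
    a ≤ 2 * C / (c * (1 - θ)) * (E ^ (1 - θ) - E' ^ (1 - θ)) + b := by
  have hθ : 0 < 1 - θ := by linarith
  have hle : E' ≤ E := by nlinarith [sq_nonneg a]
  have hΔ : 0 ≤ E ^ (1 - θ) - E' ^ (1 - θ) :=
    sub_nonneg.2 (Real.rpow_le_rpow hE' hle hθ.le)
  -- Weighted AM-GM is the tangent line inequality for t ↦ t^(1-θ) multiplied by E^θ, so E = 0 needs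
  -- no separate case.
  have hamgm := Real.geom_mean_le_arith_mean2_weighted hθ.le hθ0 hE' hE (by ring)
  have hsplit : E ^ θ * E ^ (1 - θ) = E := by
    rw [← Real.rpow_add_of_nonneg hE hθ0 hθ.le]; simp
  have hconc : (1 - θ) * (E - E') ≤ E ^ θ * (E ^ (1 - θ) - E' ^ (1 - θ)) := by
    rw [mul_sub (E ^ θ), hsplit]; nlinarith
  -- If a > b, then a + b ≤ 2a and one factor a cancels; this is the source of the 2 in the
  -- constant.
  rcases le_or_gt a b with hab | hab
  · have : 0 ≤ 2 * C / (c * (1 - θ)) * (E ^ (1 - θ) - E' ^ (1 - θ)) := by positivity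
    linarith
  · have h1 : c * (1 - θ) * a ^ 2 ≤ 2 * C * a * (E ^ (1 - θ) - E' ^ (1 - θ)) :=
      calc c * (1 - θ) * a ^ 2 = (1 - θ) * (c * a ^ 2) := by ring
        _ ≤ (1 - θ) * (E - E') := by gcongr
        _ ≤ E ^ θ * (E ^ (1 - θ) - E' ^ (1 - θ)) := hconc
        _ ≤ C * (a + b) * (E ^ (1 - θ) - E' ^ (1 - θ)) := by gcongr
        _ ≤ C * (a + a) * (E ^ (1 - θ) - E' ^ (1 - θ)) := by gcongr
        _ = _ := by ring
    have ha' : 0 < a := hb.trans_lt hab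
    have h2 : c * (1 - θ) * a ≤ 2 * C * (E ^ (1 - θ) - E' ^ (1 - θ)) := by
      refine le_of_mul_le_mul_right ?_ ha'
      nlinarith
    have h3 : a ≤ 2 * C / (c * (1 - θ)) * (E ^ (1 - θ) - E' ^ (1 - θ)) := by
      rw [div_mul_eq_mul_div, le_div_iff₀ (by positivity)]
      linarith
    linarith

/-- The tail sums of a summable nonnegative sequence, weighted by a power of the index. -/
theorem tsum_nat_add_le_rpow_mul_tsum {p : ℝ} (hp : 0 ≤ p) {v : ℕ → ℝ} (hv : ∀ j, 0 ≤ v j)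
    (hsum : Summable fun j : ℕ => ((j : ℝ) + 1) ^ p * v j) (j : ℕ) :
    ∑' i, v (i + j) ≤ ((j : ℝ) + 1) ^ (-p) * ∑' i : ℕ, ((i : ℝ) + 1) ^ p * v i := by
  have hpos : (0 : ℝ) < (j : ℝ) + 1 := by positivity
  have hterm : ∀ i : ℕ, v (i + j) ≤
      ((j : ℝ) + 1) ^ (-p) * ((((i + j : ℕ) : ℝ) + 1) ^ p * v (i + j)) := by
    intro i
    rw [← mul_assoc, Real.rpow_neg hpos.le, inv_mul_eq_div]
    refine le_mul_of_one_le_left (hv _) ((one_le_div (by positivity)).2 ?_)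
    refine Real.rpow_le_rpow hpos.le ?_ hp
    push_cast
    have : (0 : ℝ) ≤ i := by positivity
    linarith
  have hs1 := (summable_nat_add_iff j).2 hsum
  have hs2 := hs1.mul_left (((j : ℝ) + 1) ^ (-p))
  have hs3 : Summable fun i => v (i + j) := hs2.of_nonneg_of_le (fun i => hv _) hterm
  refine (hs3.tsum_le_tsum hterm hs2).trans ?_
  rw [tsum_mul_left]
  refine mul_le_mul_of_nonneg_left ?_ (by positivity)
  rw [← hsum.sum_add_tsum_nat_add j]
  have : 0 ≤ ∑ i ∈ Finset.range j, ((i : ℝ) + 1) ^ p * v i :=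
    Finset.sum_nonneg fun i _ => mul_nonneg (by positivity) (hv i)
  linarith

theorem summable_nat_add_one_rpow_neg {p : ℝ} (hp : 1 < p) :
    Summable fun j : ℕ => ((j : ℝ) + 1) ^ (-p) := by
  have := (summable_nat_add_iff 1).2 (Real.summable_nat_rpow.2 (by linarith : -p < -1))
  simpa using this

/-- AM-GM gives 2 s ≤ A s² + A⁻¹ with A = (j+1)^p, and A⁻¹ is summable because p > 1. -/
theorem summable_of_summable_rpow_mul_sq {p : ℝ} (hp : 1 < p) {s : ℕ → ℝ} (hs : ∀ j, 0 ≤ s j)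
    (hsum : Summable fun j : ℕ => ((j : ℝ) + 1) ^ p * s j ^ 2) : Summable s := by
  refine (hsum.add (summable_nat_add_one_rpow_neg hp)).of_nonneg_of_le hs fun j => ?_
  have hpos : (0 : ℝ) < ((j : ℝ) + 1) ^ p := by positivity
  have hinv : ((j : ℝ) + 1) ^ (-p) = (((j : ℝ) + 1) ^ p)⁻¹ := Real.rpow_neg (by positivity) p
  rw [hinv]
  set A := ((j : ℝ) + 1) ^ p
  have h1 : A * A⁻¹ = 1 := mul_inv_cancel₀ hpos.ne'
  have h2 : 0 < A⁻¹ := inv_pos.2 hpos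
  have h3 : A * (s j ^ 2) + A⁻¹ - 2 * s j = A⁻¹ * (A * s j - 1) ^ 2 := by
    field_simp
    ring
  have h4 : 0 ≤ A⁻¹ * (A * s j - 1) ^ 2 := by positivity
  linarith [hs j]

theorem summable_of_add_le_of_bddBelow {E a : ℕ → ℝ} (ha : ∀ j, 0 ≤ a j) {B : ℝ}
    (hB : ∀ j, B ≤ E j) (h : ∀ j, a j ≤ E j - E (j + 1)) : Summable a := by
  refine summable_of_sum_range_le (c := E 0 - B) ha fun n => ?_
  calc ∑ i ∈ Finset.range n, a i ≤ ∑ i ∈ Finset.range n, (E i - E (i + 1)) :=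
        Finset.sum_le_sum fun i _ => h i
    _ = E 0 - E n := Finset.sum_range_sub' E n
    _ ≤ _ := by linarith [hB n]

theorem exists_mapClusterPt_of_not_tendsto_norm {d : ℕ} {Z : ℕ → EuclideanSpace ℝ (Fin d)}
    (h : ¬ Tendsto (fun j => ‖Z j‖) atTop atTop) : ∃ z, MapClusterPt z atTop Z := by
  rw [tendsto_atTop] at h
  push Not at h
  obtain ⟨b, hb⟩ := h
  have hfr : ∃ᶠ j in atTop, Z j ∈ Metric.closedBall 0 b := by
    refine hb.mono fun j hj => ?_
    rw [mem_closedBall_zero_iff]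
    exact hj.le
  obtain ⟨z, -, hz⟩ := (isCompact_closedBall (0 : EuclideanSpace ℝ (Fin d))
    b).exists_mapClusterPt_of_frequently hfr
  exact ⟨z, hz⟩

/-- Convergence of inexact descent sequences under the Łojasiewicz inequality. The sequence `Z`
approximately decreases the Lyapunov function `f (Z j) + D j ^ 2`, with errors `s j` that are square
summable against the weights `(j + 1) ^ p` for some `p > 1`. -/
theorem inexact_descent_dichotomy {d : ℕ} {f : EuclideanSpace ℝ (Fin d) → ℝ}
    (hfc : Continuous f) (hgc : Continuous (∇ f)) (hbdd : ∃ B : ℝ, ∀ x, B ≤ f x)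
    (hloj : ∀ xs ∈ critSet f, LojasiewiczAt f xs)
    {Z : ℕ → EuclideanSpace ℝ (Fin d)} {D s : ℕ → ℝ} (hD : ∀ j, 0 ≤ D j) (hs : ∀ j, 0 ≤ s j)
    {p c C : ℝ} (hp : 1 < p) (hc : 0 < c) (hC : 0 < C)
    (hsum : Summable fun j : ℕ => ((j : ℝ) + 1) ^ p * s j ^ 2)
    (hdec : ∀ j, f (Z (j + 1)) + D (j + 1) ^ 2 ≤
      f (Z j) + D j ^ 2 - c * (‖∇ f (Z j)‖ ^ 2 + D j ^ 2) + C * s j ^ 2)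
    (hstep : ∀ j, ‖Z (j + 1) - Z j‖ ≤ C * (‖∇ f (Z j)‖ + D j + s j)) :
    Tendsto (fun j => ‖∇ f (Z j)‖ + D j + s j) atTop (𝓝 0) ∧
      (Tendsto (fun j => ‖Z j‖) atTop atTop ∨ ∃ xs ∈ critSet f, Tendsto Z atTop (𝓝 xs)) := by
  obtain ⟨B, hB⟩ := hbdd
  set v : ℕ → ℝ := fun j => C * s j ^ 2 with hv
  have hv0 : ∀ j, 0 ≤ v j := fun j => by positivity
  have hvsum : Summable fun j : ℕ => ((j : ℝ) + 1) ^ p * v j := by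
    refine (hsum.mul_left C).congr fun j => ?_
    simp only [hv]; ring
  have hvs : Summable v := by
    refine hvsum.of_nonneg_of_le hv0 fun j => le_mul_of_one_le_left (hv0 j) ?_
    exact Real.one_le_rpow (by simp) (by linarith)
  -- The tail u pays for all future errors: u j - u (j+1) = v j cancels the error of step j, so F
  -- below is nonincreasing.
  set u : ℕ → ℝ := fun j => ∑' i, v (i + j) with hu
  have hu0 : ∀ j, 0 ≤ u j := fun j => tsum_nonneg fun i => hv0 _
  have husucc : ∀ j, u j = v j + u (j + 1) := by
    intro j
    have := ((summable_nat_add_iff j).2 hvs).tsum_eq_zero_add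
    simp only [hu]
    rw [this]
    simp [add_assoc, add_comm 1 j]
  have hulim : Tendsto u atTop (𝓝 0) := tendsto_sum_nat_add v
  have hssum : Summable s := summable_of_summable_rpow_mul_sq hp hs hsum
  have hslim : Tendsto s atTop (𝓝 0) := hssum.tendsto_atTop_zero
  set F : ℕ → ℝ := fun j => f (Z j) + D j ^ 2 + u j with hF
  have hFB : ∀ j, B ≤ F j := fun j => by
    have h1 := hB (Z j)
    have h2 := hu0 j
    have h3 := sq_nonneg (D j)
    simp only [hF]; linarith
  have hFdec : ∀ j, c * (‖∇ f (Z j)‖ ^ 2 + D j ^ 2) ≤ F j - F (j + 1) := fun j => by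
    have h1 := hdec j
    have h2 := husucc j
    simp only [hF, hv] at h2 ⊢; linarith
  have hsq : Summable fun j => c * (‖∇ f (Z j)‖ ^ 2 + D j ^ 2) :=
    summable_of_add_le_of_bddBelow (fun j => by positivity) hFB hFdec
  have hsqlim : Tendsto (fun j => ‖∇ f (Z j)‖ ^ 2 + D j ^ 2) atTop (𝓝 0) := by
    have := hsq.tendsto_atTop_zero.const_mul c⁻¹
    simpa [inv_mul_cancel_left₀ hc.ne'] using this
  have hroot : Tendsto (fun j => √(‖∇ f (Z j)‖ ^ 2 + D j ^ 2)) atTop (𝓝 0) := by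
    simpa using hsqlim.sqrt
  have hG : Tendsto (fun j => ‖∇ f (Z j)‖) atTop (𝓝 0) :=
    squeeze_zero (fun j => norm_nonneg _)
      (fun j => Real.le_sqrt_of_sq_le (by linarith [sq_nonneg (D j)])) hroot
  have hDlim : Tendsto D atTop (𝓝 0) :=
    squeeze_zero hD
      (fun j => Real.le_sqrt_of_sq_le (by linarith [sq_nonneg ‖∇ f (Z j)‖])) hroot
  refine ⟨by simpa using (hG.add hDlim).add hslim, ?_⟩
  rw [or_iff_not_imp_left]
  intro hnot
  obtain ⟨z, hz⟩ := exists_mapClusterPt_of_not_tendsto_norm hnot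
  -- the limit value of the Lyapunov function
  have hanti : Antitone F := antitone_nat_of_succ_le fun j => by
    have h1 := hFdec j
    have h2 : 0 ≤ c * (‖∇ f (Z j)‖ ^ 2 + D j ^ 2) := by positivity
    linarith
  have hFlim : Tendsto F atTop (𝓝 (⨅ j, F j)) :=
    tendsto_atTop_ciInf hanti ⟨B, by rintro _ ⟨j, rfl⟩; exact hFB j⟩
  have hfZ : Tendsto (fun j => f (Z j)) atTop (𝓝 (⨅ j, F j)) := by
    have := (hFlim.sub (hDlim.pow 2)).sub hulim
    simp only [hF] at this ⊢
    refine (this.congr fun j => by ring).trans_eq ?_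
    simp
  obtain ⟨φ, hφ, hφz⟩ := hz.tendsto_subseq
  have hfz : (⨅ j, F j) = f z :=
    tendsto_nhds_unique (hfZ.comp hφ.tendsto_atTop) ((hfc.tendsto z).comp hφz)
  have hgz : z ∈ critSet f := by
    have := tendsto_nhds_unique (hG.comp hφ.tendsto_atTop)
      ((hgc.norm.tendsto z).comp hφz)
    exact norm_eq_zero.1 this.symm
  refine ⟨z, hgz, ?_⟩
  -- The choice θ > 1/p makes u^θ summable, since u j is at most a constant times (j+1)^(-p).
  obtain ⟨θ, hθ, hθ1, hqθ, C₀, hC₀, hL⟩ :=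
    (hloj z hgz).exists_exponent_gt hfc.continuousAt (q := 1 / p) (by rw [div_lt_one] <;> linarith)
  have hθ0 : 0 < θ := by linarith
  have hpθ : 1 < p * θ := by
    rw [div_lt_iff₀ (by linarith)] at hqθ; linarith
  set E : ℕ → ℝ := fun j => F j - f z with hE
  have hE0 : ∀ j, 0 ≤ E j := fun j => by
    have := hanti.le_of_tendsto hFlim j
    simp only [hE]; linarith
  have hElim : Tendsto E atTop (𝓝 0) := by
    have := hFlim.sub_const (f z)
    rwa [hfz, sub_self] at this
  have huθ : Summable fun j => u j ^ θ := by
    set S := ∑' i : ℕ, ((i : ℝ) + 1) ^ p * v i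
    have hS : 0 ≤ S := tsum_nonneg fun i => mul_nonneg (by positivity) (hv0 i)
    refine ((summable_nat_add_one_rpow_neg hpθ).mul_right (S ^ θ)).of_nonneg_of_le
      (fun j => Real.rpow_nonneg (hu0 j) _) fun j => ?_
    have h1 := tsum_nat_add_le_rpow_mul_tsum (by linarith) hv0 hvsum j
    have h2 := Real.rpow_le_rpow (hu0 j) h1 hθ0.le
    rwa [Real.mul_rpow (by positivity) hS, ← Real.rpow_mul (by positivity), neg_mul] at h2
  set a : ℕ → ℝ := fun j => ‖∇ f (Z j)‖ + D j with ha
  set w : ℕ → ℝ := fun j => C * (u j ^ θ + s j) with hw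
  have hwsum : Summable w := (huθ.add hssum).mul_left C
  have hw0 : ∀ j, 0 ≤ w j := fun j =>
    mul_nonneg hC.le (add_nonneg (Real.rpow_nonneg (hu0 j) _) (hs j))
  -- The constant of `le_rpow_sub_rpow_add_of_decrease`: c / 2 comes from (G + D)² ≤ 2 (G² + D²),
  -- and the 1 in C₀ + 1 covers D and u^θ.
  set K : ℝ := 2 * (C₀ + 1) / (c / 2 * (1 - θ)) with hK
  have hK0 : 0 ≤ K := by
    have : 0 < 1 - θ := by linarith
    positivity
  set P : ℕ → ℝ := fun j => C * K * E j ^ (1 - θ) + ∑' i, w (i + j) with hP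
  refine tendsto_of_dist_le_sub_of_mapClusterPt (P := P) (fun j => ?_) ?_ hz
    ⟨_, hL, ?_⟩
  · exact add_nonneg (mul_nonneg (mul_nonneg hC.le hK0) (Real.rpow_nonneg (hE0 j) _))
      (tsum_nonneg fun i => hw0 _)
  · have h1 : Tendsto (fun j => E j ^ (1 - θ)) atTop (𝓝 0) := by
      have := hElim.rpow_const (p := 1 - θ) (Or.inr (by linarith))
      rwa [Real.zero_rpow (by linarith)] at this
    simpa [hP] using (h1.const_mul (C * K)).add (tendsto_sum_nat_add w)
  · filter_upwards [hDlim.eventually_lt_const one_pos] with j hDj hj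
    have hj' : |f (Z j) - f z| ^ θ ≤ C₀ * ‖∇ f (Z j)‖ := hj
    have hwsucc : ∑' i, w (i + j) = w j + ∑' i, w (i + (j + 1)) := by
      have := ((summable_nat_add_iff j).2 hwsum).tsum_eq_zero_add
      rw [this]
      simp [add_assoc, add_comm 1 j]
    -- Here θ ≥ 1/2 enters: 2θ ≥ 1 and D j < 1.
    have hDθ : (D j ^ 2) ^ θ ≤ D j := by
      rw [← Real.rpow_natCast, ← Real.rpow_mul (hD j)]
      calc D j ^ (((2 : ℕ) : ℝ) * θ) ≤ D j ^ (1 : ℝ) :=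
            Real.rpow_le_rpow_of_exponent_ge' (hD j) hDj.le zero_le_one (by push_cast; linarith)
        _ = D j := Real.rpow_one _
    have hEθ : E j ^ θ ≤ (C₀ + 1) * (a j + u j ^ θ) := by
      have hu' : 0 ≤ u j ^ θ := Real.rpow_nonneg (hu0 j) _
      calc E j ^ θ ≤ (|f (Z j) - f z| + D j ^ 2 + u j) ^ θ := by
            refine Real.rpow_le_rpow (hE0 j) ?_ hθ0.le
            simp only [hE, hF]
            linarith [le_abs_self (f (Z j) - f z)]
        _ ≤ (|f (Z j) - f z| + D j ^ 2) ^ θ + u j ^ θ :=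
            Real.rpow_add_le_add_rpow (by positivity) (hu0 j) hθ0.le hθ1.le
        _ ≤ |f (Z j) - f z| ^ θ + (D j ^ 2) ^ θ + u j ^ θ := by
            gcongr
            exact Real.rpow_add_le_add_rpow (by positivity) (by positivity) hθ0.le hθ1.le
        _ ≤ C₀ * ‖∇ f (Z j)‖ + D j + u j ^ θ := by gcongr
        _ ≤ (C₀ + 1) * (a j + u j ^ θ) := by
            have h1 := mul_nonneg hC₀.le (hD j)
            have h2 := mul_nonneg hC₀.le hu'
            have h3 := norm_nonneg (∇ f (Z j))
            simp only [ha]; linarith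
    have hdec' : c / 2 * a j ^ 2 ≤ E j - E (j + 1) := by
      have h1 := hFdec j
      have h2 := mul_nonneg hc.le (sq_nonneg (‖∇ f (Z j)‖ - D j))
      simp only [hE, ha]; nlinarith
    have hlen := le_rpow_sub_rpow_add_of_decrease hθ0.le hθ1
      (Real.rpow_nonneg (hu0 j) θ) (half_pos hc) (by linarith : 0 < C₀ + 1) (hE0 j) (hE0 (j + 1))
      hdec' hEθ
    have hst := hstep j
    have hlenC := mul_le_mul_of_nonneg_left hlen hC.le
    rw [dist_eq_norm]
    simp only [hP, hwsucc]
    simp only [ha, hw] at hlenC ⊢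
    rw [← hK] at hlenC
    linarith

/-! ### One block of momentum steps as an inexact gradient step -/

/-- First order Taylor bound for a function with Lipschitz gradient. -/
theorem le_add_inner_gradient_add_mul_norm_sq {F : Type*} [NormedAddCommGroup F]
    [InnerProductSpace ℝ F] [CompleteSpace F] {f : F → ℝ} (hf : Differentiable ℝ f) {L : ℝ≥0}
    (hL : LipschitzWith L (∇ f)) (x y : F) :
    f y ≤ f x + inner ℝ (∇ f x) (y - x) + L * ‖y - x‖ ^ 2 := by
  -- The mean value inequality for f minus its linearization yields the constant L instead of the
  -- sharp L/2, which suffices here.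
  have hbound : ∀ w ∈ segment ℝ x y,
      ‖fderiv ℝ f w - InnerProductSpace.toDual ℝ F (∇ f x)‖ ≤ L * ‖y - x‖ := by
    intro w hw
    have h1 : fderiv ℝ f w = InnerProductSpace.toDual ℝ F (∇ f w) := by
      simp [gradient]
    rw [h1, ← map_sub, LinearIsometryEquiv.norm_map, ← dist_eq_norm]
    refine (hL.dist_le_mul w x).trans ?_
    gcongr
    rw [dist_comm, ← dist_eq_norm, dist_comm y x]
    have := dist_add_dist_of_mem_segment hw
    linarith [dist_nonneg (x := w) (y := y)]
  have h := (convex_segment x y).norm_image_sub_le_of_norm_hasFDerivWithin_le'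
    (fun w _ => (hf w).hasFDerivAt.hasFDerivWithinAt) hbound (left_mem_segment ℝ x y)
    (right_mem_segment ℝ x y)
  rw [InnerProductSpace.toDual_apply_apply, Real.norm_eq_abs] at h
  have := le_abs_self (f y - f x - inner ℝ (∇ f x) (y - x))
  nlinarith

section Window

variable {F : Type*} [NormedAddCommGroup F] [NormedSpace ℝ F]

/-- Bound on the momentum term over a block of `n` steps with noise partial sums at most `s`. -/
theorem norm_momentum_le {n : ℕ} {a : ℕ → ℝ} {g e v : ℕ → F} {lam A M s : ℝ}
    (hlam0 : 0 ≤ lam) (hlam1 : lam < 1)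
    (hA : 0 ≤ A) (hM0 : 0 ≤ M) (ha0 : ∀ i < n, 0 ≤ a i) (haA : ∀ i < n, a i ≤ A)
    (hM : ∀ i < n, ‖g i‖ ≤ M) (hs : ∀ i ≤ n, ‖∑ l ∈ Finset.range i, a l • e l‖ ≤ s)
    (hv : ∀ i < n, v (i + 1) = lam • v i - a i • (g i - e i)) :
    ∀ i ≤ n, ‖v i‖ ≤ lam ^ i * ‖v 0‖ + A * M * (1 - lam)⁻¹ + 2 * s := by
  have hh : 0 < 1 - lam := by linarith
  have hs0 : 0 ≤ s := (norm_nonneg _).trans (hs 0 (Nat.zero_le n))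
  have hinv : (1 - lam) * (1 - lam)⁻¹ = 1 := mul_inv_cancel₀ hh.ne'
  -- With the noise partial sum S subtracted, q = v - S satisfies q' = λ q - (1-λ) S - a g, so the
  -- noise enters only through partial sums and never through single errors.
  have hq : ∀ i ≤ n, ‖v i - ∑ l ∈ Finset.range i, a l • e l‖ ≤
      lam ^ i * ‖v 0‖ + A * M * (1 - lam)⁻¹ + s := by
    intro i
    induction i with
    | zero =>
      intro _
      have : 0 ≤ A * M * (1 - lam)⁻¹ := mul_nonneg (mul_nonneg hA hM0) (inv_nonneg.2 hh.le)
      simp; linarith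
    | succ i ih =>
      intro hi
      have hi' : i < n := hi
      have h1 : v (i + 1) - ∑ l ∈ Finset.range (i + 1), a l • e l =
          lam • (v i - ∑ l ∈ Finset.range i, a l • e l)
            - (1 - lam) • (∑ l ∈ Finset.range i, a l • e l) - a i • g i := by
        rw [hv i hi', Finset.sum_range_succ]; module
      have h2 : ‖a i • g i‖ ≤ A * M := by
        rw [norm_smul, Real.norm_of_nonneg (ha0 i hi')]
        exact mul_le_mul (haA i hi') (hM i hi') (norm_nonneg _) ((ha0 i hi').trans (haA i hi'))
      rw [h1]
      calc _ ≤ ‖lam • (v i - ∑ l ∈ Finset.range i, a l • e l)‖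
            + ‖(1 - lam) • (∑ l ∈ Finset.range i, a l • e l)‖ + ‖a i • g i‖ :=
            (norm_sub_le _ _).trans (add_le_add_left (norm_sub_le _ _) _)
        _ ≤ lam * (lam ^ i * ‖v 0‖ + A * M * (1 - lam)⁻¹ + s) + (1 - lam) * s + A * M := by
            rw [norm_smul, norm_smul, Real.norm_of_nonneg hlam0, Real.norm_of_nonneg hh.le]
            gcongr
            · exact ih hi'.le
            · exact hs i hi'.le
        _ = lam ^ (i + 1) * ‖v 0‖ + A * M * (1 - lam)⁻¹ + s := by
            linear_combination (-A * M) * hinv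
  intro i hi
  have h1 := hq i hi
  have h2 := hs i hi
  have h3 := norm_add_le (v i - ∑ l ∈ Finset.range i, a l • e l)
    (∑ l ∈ Finset.range i, a l • e l)
  rw [sub_add_cancel] at h3
  linarith

/-- The averaged iterates of a block in terms of accumulated gradients and noise. -/
theorem averaged_iterate_eq {n : ℕ} {a : ℕ → ℝ} {g e z : ℕ → F} {b : ℝ}
    (hz : ∀ i < n, z (i + 1) = z i - (a i * b) • (g i - e i)) :
    ∀ i ≤ n, z i = z 0 - b • ∑ l ∈ Finset.range i, a l • g l
      + b • ∑ l ∈ Finset.range i, a l • e l := by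
  intro i
  induction i with
  | zero => simp
  | succ i ih =>
    intro hi
    rw [hz i hi, ih (by omega), Finset.sum_range_succ, Finset.sum_range_succ]
    module

/-- Deviation of the iterates from the starting point of a block. -/
theorem norm_averaged_iterate_sub_le {n : ℕ} {a : ℕ → ℝ} {g e z : ℕ → F} {b M s T : ℝ}
    (hb : 0 ≤ b) (hM0 : 0 ≤ M) (ha0 : ∀ i < n, 0 ≤ a i)
    (haT : ∑ l ∈ Finset.range n, a l = T) (hM : ∀ i < n, ‖g i‖ ≤ M)
    (hs : ∀ i ≤ n, ‖∑ l ∈ Finset.range i, a l • e l‖ ≤ s)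
    (hz : ∀ i < n, z (i + 1) = z i - (a i * b) • (g i - e i)) :
    ∀ i ≤ n, ‖z i - z 0‖ ≤ b * (T * M + s) := by
  intro i hi
  have h1 : z i - z 0 =
      b • (∑ l ∈ Finset.range i, a l • e l - ∑ l ∈ Finset.range i, a l • g l) := by
    rw [averaged_iterate_eq hz i hi]; module
  have h2 : ‖∑ l ∈ Finset.range i, a l • g l‖ ≤ T * M := by
    calc ‖∑ l ∈ Finset.range i, a l • g l‖ ≤ ∑ l ∈ Finset.range i, a l * M := by
          refine norm_sum_le_of_le _ fun l hl => ?_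
          have hl' : l < n := (Finset.mem_range.1 hl).trans_le hi
          rw [norm_smul, Real.norm_of_nonneg (ha0 l hl')]
          exact mul_le_mul_of_nonneg_left (hM l hl') (ha0 l hl')
      _ = (∑ l ∈ Finset.range i, a l) * M := (Finset.sum_mul _ _ _).symm
      _ ≤ T * M := by
          rw [← haT]
          refine mul_le_mul_of_nonneg_right ?_ hM0
          refine Finset.sum_le_sum_of_subset_of_nonneg (Finset.range_mono hi) fun l hl _ => ?_
          exact ha0 l (Finset.mem_range.1 hl)
  rw [h1, norm_smul, Real.norm_of_nonneg hb]
  refine mul_le_mul_of_nonneg_left ((norm_sub_le _ _).trans ?_) hb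
  linarith [hs i hi]

theorem sum_mul_pow_le {n : ℕ} {a : ℕ → ℝ} {lam A : ℝ} (hlam0 : 0 ≤ lam) (hlam1 : lam < 1)
    (hA : 0 ≤ A) (haA : ∀ i < n, a i ≤ A) :
    ∑ i ∈ Finset.range n, a i * lam ^ i ≤ A * (1 - lam)⁻¹ := by
  calc ∑ i ∈ Finset.range n, a i * lam ^ i ≤ ∑ i ∈ Finset.range n, A * lam ^ i :=
        Finset.sum_le_sum fun i hi =>
          mul_le_mul_of_nonneg_right (haA i (Finset.mem_range.1 hi)) (pow_nonneg hlam0 i)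
    _ = A * ∑ i ∈ Finset.range n, lam ^ i := (Finset.mul_sum _ _ _).symm
    _ ≤ A * ∑' i, lam ^ i := by
        gcongr
        exact (summable_geometric_of_lt_one hlam0 hlam1).sum_le_tsum _
          fun i _ => pow_nonneg hlam0 i
    _ = A * (1 - lam)⁻¹ := by rw [tsum_geometric_of_lt_one hlam0 hlam1]

set_option maxHeartbeats 1000000 in
/-- A block of stochastic momentum steps of total length `T` is a single inexact gradient step of
length `T / (1 - lam)`. Here `z` are the averaged iterates, `v` the momentum vectors, and `γ` the
gradient at the starting point `z 0`. -/
theorem block_estimates {L κ lam : ℝ} (hL : 0 ≤ L) (hκ : 0 ≤ κ) (hlam0 : 0 ≤ lam)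
    (hlam1 : lam < 1) :
    ∃ K T₀ : ℝ, 1 ≤ K ∧ 0 < T₀ ∧ ∀ (n : ℕ) (a : ℕ → ℝ) (g e z v : ℕ → F) (γ : F) (A T s : ℝ),
      0 ≤ A → A ≤ T ^ 2 → 0 ≤ T → T ≤ T₀ →
      (∀ i < n, 0 ≤ a i) → (∀ i < n, a i ≤ A) → ∑ l ∈ Finset.range n, a l = T →
      (∀ i ≤ n, ‖∑ l ∈ Finset.range i, a l • e l‖ ≤ s) →
      (∀ i < n, z (i + 1) = z i - (a i * (1 - lam)⁻¹) • (g i - e i)) →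
      (∀ i < n, v (i + 1) = lam • v i - a i • (g i - e i)) →
      (∀ i < n, ‖g i - γ‖ ≤ L * (‖z i - z 0‖ + κ * ‖v i‖)) →
      ‖z n - z 0 + (T * (1 - lam)⁻¹) • γ‖ ≤ K * (T ^ 2 * (‖γ‖ + ‖v 0‖) + s) ∧
      ‖v n‖ ≤ lam ^ n * ‖v 0‖ + K * (T ^ 2 * (‖γ‖ + ‖v 0‖) + s) ∧
      (∀ i ≤ n, ‖z i - z 0‖ ≤ K * (‖γ‖ + ‖v 0‖ + s)) ∧
      (∀ i ≤ n, ‖v i‖ ≤ K * (‖γ‖ + ‖v 0‖ + s)) := by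
  have hh : 0 < 1 - lam := by linarith
  set b := (1 - lam)⁻¹ with hb
  have hb1 : 1 ≤ b := (one_le_inv₀ hh).2 (by linarith)
  have hb0 : 0 ≤ b := by linarith
  set B := L * (1 + κ) * b with hB
  have hB0 : 0 ≤ B := by positivity
  have hLB : L * b ≤ B := by
    have : 0 ≤ L * κ * b := by positivity
    rw [hB]; linarith
  have hLκ : L * κ ≤ B := by
    have h1 : L * κ * 1 ≤ L * κ * b := by gcongr
    have : 0 ≤ L * b := by positivity
    rw [hB]; linarith
  have hLκb : L * κ * b + L * b = B := by rw [hB]; ring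
  -- The first witness dominates every coefficient of ‖γ‖, ‖v 0‖ and s arising below; the second
  -- ensures 4BT ≤ 1.
  refine ⟨(12 * B ^ 2 + 12 * B + B * b + 2) * b + 3, min 1 (1 / (4 * (B + 1))), ?_,
    by positivity, ?_⟩
  · have : 0 ≤ (12 * B ^ 2 + 12 * B + B * b + 2) * b := by positivity
    linarith
  intro n a g e z v γ A T s hA hAT hT hTT ha0 haA haT hs hz hv hg
  have hT1 : T ≤ 1 := hTT.trans (min_le_left _ _)
  have hT2 : T ^ 2 ≤ T := by nlinarith
  have hBT : 4 * (B * T) ≤ 1 := by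
    have h1 : T ≤ 1 / (4 * (B + 1)) := hTT.trans (min_le_right _ _)
    rw [le_div_iff₀ (by positivity)] at h1
    nlinarith
  have hs0 : 0 ≤ s := (norm_nonneg _).trans (hs 0 (Nat.zero_le n))
  set G := ‖γ‖ with hG
  set D := ‖v 0‖ with hD
  have hG0 : 0 ≤ G := norm_nonneg _
  have hD0 : 0 ≤ D := norm_nonneg _
  -- deviation of the gradients, given a bound `M` for them
  have hdev : ∀ M, 0 ≤ M → (∀ i < n, ‖g i‖ ≤ M) → ∀ i < n,
      ‖g i - γ‖ ≤ 2 * B * T * M + 3 * B * s + B * D * lam ^ i := by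
    intro M hM0 hM i hi
    have h1 := norm_averaged_iterate_sub_le hb0 hM0 ha0 haT hM hs hz i hi.le
    have h2 := norm_momentum_le hlam0 hlam1 hA hM0 ha0 haA hM hs hv i hi.le
    rw [← hb, ← hD] at h2
    have hlami : 0 ≤ lam ^ i := pow_nonneg hlam0 i
    calc ‖g i - γ‖ ≤ L * (‖z i - z 0‖ + κ * ‖v i‖) := hg i hi
      _ ≤ L * (b * (T * M + s) + κ * (lam ^ i * D + A * M * b + 2 * s)) := by gcongr
      _ ≤ L * (b * (T * M + s) + κ * (lam ^ i * D + T * M * b + 2 * s)) := by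
          have : A ≤ T := hAT.trans hT2
          gcongr
      _ = B * (T * M) + (L * b) * s + (L * κ) * (lam ^ i * D) + (L * κ) * (2 * s) := by
          rw [← hLκb]; ring
      _ ≤ B * (T * M) + B * s + B * (lam ^ i * D) + B * (2 * s) := by gcongr
      _ ≤ _ := by nlinarith [mul_nonneg (mul_nonneg hB0 hT) hM0]
  set M := 2 * G + 2 * B * D + 6 * B * s with hM
  have hM0 : 0 ≤ M := by positivity
  -- Apply `hdev` with M equal to the largest ‖g i‖: its term 2BT·M is at most M/2 and is absorbed
  -- on the left, which gives the value of `M`.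
  have hgM : ∀ i < n, ‖g i‖ ≤ M := by
    rcases Nat.eq_zero_or_pos n with rfl | hn
    · intro i hi; omega
    obtain ⟨i₀, hi₀, hmax⟩ := Finset.exists_max_image (Finset.range n) (fun i => ‖g i‖)
      ⟨0, Finset.mem_range.2 hn⟩
    have hi₀' := Finset.mem_range.1 hi₀
    have h1 := hdev ‖g i₀‖ (norm_nonneg _) (fun i hi => hmax i (Finset.mem_range.2 hi)) i₀ hi₀'
    have h2 : ‖g i₀‖ ≤ ‖g i₀ - γ‖ + G := by simpa using norm_add_le (g i₀ - γ) γ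
    have h3 : B * D * lam ^ i₀ ≤ B * D :=
      mul_le_of_le_one_right (by positivity) (pow_le_one₀ hlam0 hlam1.le)
    have h4 : 4 * (B * T) * ‖g i₀‖ ≤ 1 * ‖g i₀‖ := by gcongr
    intro i hi
    refine (hmax i (Finset.mem_range.2 hi)).trans ?_
    simp only [hM]
    linarith
  have hdevM := hdev M hM0 hgM
  have hzi := norm_averaged_iterate_sub_le hb0 hM0 ha0 haT hgM hs hz
  have hvi := norm_momentum_le hlam0 hlam1 hA hM0 ha0 haA hgM hs hv
  rw [← hb, ← hD] at hvi
  have hT0 : 0 ≤ T ^ 2 := sq_nonneg T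
  have hT21 : T ^ 2 ≤ 1 := hT2.trans hT1
  refine ⟨?_, ?_, ?_, ?_⟩
  -- The initial momentum decays geometrically, so its share is O(A), hence O(T²) by A ≤ T².
  · have hsum : ‖∑ l ∈ Finset.range n, a l • (g l - γ)‖ ≤
        T * (2 * B * T * M + 3 * B * s) + B * D * (A * b) := by
      calc _ ≤ ∑ l ∈ Finset.range n, (a l * (2 * B * T * M + 3 * B * s)
              + B * D * (a l * lam ^ l)) := by
            refine norm_sum_le_of_le _ fun l hl => ?_
            have hl' := Finset.mem_range.1 hl
            rw [norm_smul, Real.norm_of_nonneg (ha0 l hl')]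
            refine (mul_le_mul_of_nonneg_left (hdevM l hl') (ha0 l hl')).trans (le_of_eq ?_)
            ring
        _ = T * (2 * B * T * M + 3 * B * s)
              + B * D * ∑ l ∈ Finset.range n, a l * lam ^ l := by
            rw [Finset.sum_add_distrib, ← Finset.sum_mul, haT, ← Finset.mul_sum]
        _ ≤ _ := by
            gcongr
            exact sum_mul_pow_le hlam0 hlam1 hA haA
    have heq : z n - z 0 + (T * b) • γ =
        b • (∑ l ∈ Finset.range n, a l • e l - ∑ l ∈ Finset.range n, a l • (g l - γ)) := by
      rw [averaged_iterate_eq hz n le_rfl, ← haT]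
      simp only [smul_sub, Finset.sum_sub_distrib, ← Finset.sum_smul]
      module
    rw [heq, norm_smul, Real.norm_of_nonneg hb0]
    calc b * ‖_‖ ≤ b * (s + (T * (2 * B * T * M + 3 * B * s) + B * D * (A * b))) := by
          gcongr
          exact (norm_sub_le _ _).trans (add_le_add (hs n le_rfl) hsum)
      _ ≤ b * (s + (2 * B * T ^ 2 * M + 3 * B * (T * s) + B * D * (T ^ 2 * b))) := by
          have : B * D * (A * b) ≤ B * D * (T ^ 2 * b) := by gcongr
          refine mul_le_mul_of_nonneg_left ?_ hb0
          nlinarith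
      _ = T ^ 2 * ((4 * B * b) * G + (4 * B ^ 2 + B * b) * b * D)
            + (b + 12 * B ^ 2 * b * T ^ 2 + 3 * B * b * T) * s := by rw [hM]; ring
      _ ≤ T ^ 2 * (((12 * B ^ 2 + 12 * B + B * b + 2) * b + 3) * G
            + ((12 * B ^ 2 + 12 * B + B * b + 2) * b + 3) * D)
            + ((12 * B ^ 2 + 12 * B + B * b + 2) * b + 3) * s := by
          have e1 : 4 * B * b ≤ (12 * B ^ 2 + 12 * B + B * b + 2) * b + 3 := by
            have : 0 ≤ (12 * B ^ 2 + 8 * B + B * b + 2) * b + 3 := by positivity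
            linarith
          have e2 : (4 * B ^ 2 + B * b) * b ≤ (12 * B ^ 2 + 12 * B + B * b + 2) * b + 3 := by
            have : 0 ≤ (8 * B ^ 2 + 12 * B + 2) * b + 3 := by positivity
            linarith
          have e3 : b + 12 * B ^ 2 * b * T ^ 2 + 3 * B * b * T ≤
              (12 * B ^ 2 + 12 * B + B * b + 2) * b + 3 := by
            have h1 : 12 * B ^ 2 * b * T ^ 2 ≤ 12 * B ^ 2 * b * 1 := by gcongr
            have h2 : 3 * B * b * T ≤ 3 * B * b * 1 := by gcongr
            have : 0 ≤ (9 * B + B * b + 1) * b + 3 := by positivity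
            linarith
          gcongr
      _ = _ := by ring
  · have h1 := hvi n le_rfl
    have h2 : A * M * b ≤ T ^ 2 * M * b := by gcongr
    have h3 : T ^ 2 * M * b + 2 * s ≤
        ((12 * B ^ 2 + 12 * B + B * b + 2) * b + 3) * (T ^ 2 * (G + D) + s) := by
      calc T ^ 2 * M * b + 2 * s = T ^ 2 * ((2 * b) * G + (2 * B * b) * D)
            + (6 * B * b * T ^ 2 + 2) * s := by rw [hM]; ring
        _ ≤ T ^ 2 * (((12 * B ^ 2 + 12 * B + B * b + 2) * b + 3) * G
            + ((12 * B ^ 2 + 12 * B + B * b + 2) * b + 3) * D)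
            + ((12 * B ^ 2 + 12 * B + B * b + 2) * b + 3) * s := by
          have e1 : 2 * b ≤ (12 * B ^ 2 + 12 * B + B * b + 2) * b + 3 := by
            have : 0 ≤ (12 * B ^ 2 + 12 * B + B * b) * b + 3 := by positivity
            linarith
          have e2 : 2 * B * b ≤ (12 * B ^ 2 + 12 * B + B * b + 2) * b + 3 := by
            have : 0 ≤ (12 * B ^ 2 + 10 * B + B * b + 2) * b + 3 := by positivity
            linarith
          have e3 : 6 * B * b * T ^ 2 + 2 ≤ (12 * B ^ 2 + 12 * B + B * b + 2) * b + 3 := by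
            have h1 : 6 * B * b * T ^ 2 ≤ 6 * B * b * 1 := by gcongr
            have : 0 ≤ (12 * B ^ 2 + 6 * B + B * b + 2) * b + 1 := by positivity
            linarith
          gcongr
        _ = _ := by ring
    linarith
  · intro i hi
    refine (hzi i hi).trans ?_
    have h1 : b * (T * M + s) ≤ b * (1 * M + s) := by gcongr
    refine h1.trans ?_
    have : 0 ≤ ((12 * B ^ 2 + 12 * B + B * b) * b + 3) * G
      + ((12 * B ^ 2 + 10 * B + B * b + 2) * b + 3) * D
      + ((12 * B ^ 2 + 6 * B + B * b + 1) * b + 3) * s := by positivity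
    rw [hM]
    linarith
  · intro i hi
    refine (hvi i hi).trans ?_
    have h1 : A * M * b ≤ 1 * M * b := by
      have : A ≤ 1 := hAT.trans hT21
      gcongr
    have h2 : lam ^ i * D ≤ D := mul_le_of_le_one_left hD0 (pow_le_one₀ hlam0 hlam1.le)
    have : 0 ≤ ((12 * B ^ 2 + 12 * B + B * b) * b + 3) * G
      + ((12 * B ^ 2 + 10 * B + B * b + 2) * b + 2) * D
      + ((12 * B ^ 2 + 6 * B + B * b + 2) * b + 1) * s := by positivity
    rw [hM] at h1
    linarith

end Window

set_option maxHeartbeats 1000000 in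
/-- Elementary inequality behind the decrease of the Lyapunov function over a block. -/
theorem lyapunov_decrease_arith {f₀ f₁ G D D' R s T b K L Q : ℝ} (hG : 0 ≤ G) (hD : 0 ≤ D)
    (hD' : 0 ≤ D') (hR : 0 ≤ R) (hT : 0 < T) (hT1 : T ≤ 1) (hb : 1 ≤ b)
    (hK : 1 ≤ K) (hL : 0 ≤ L) (hKQ : K ^ 2 ≤ Q) (hLKQ : L * K ^ 2 ≤ Q) (hLbQ : L * b ^ 2 ≤ Q)
    (hQT : Q * T ≤ 1 / 100)
    (hRle : R ≤ K * (T ^ 2 * (G + D) + s)) (hD'le : D' ≤ 1 / 4 * D + K * (T ^ 2 * (G + D) + s))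
    (hf : f₁ ≤ f₀ - T * b * G ^ 2 + G * R + L * (T * b * G + R) ^ 2) :
    f₁ + D' ^ 2 ≤ f₀ + D ^ 2 - (T / 4 * G ^ 2 + 1 / 8 * D ^ 2) + (Q / T + 9 * Q) * s ^ 2 := by
  have hKK : K ≤ Q := by nlinarith
  have hQ0 : 0 ≤ Q := by linarith
  have hKT : K * T ≤ 1 / 100 := (mul_le_mul_of_nonneg_right hKK hT.le).trans hQT
  have hKT2 : K * T ^ 2 ≤ T / 100 := by nlinarith
  have hsqR : (K * (T ^ 2 * (G + D) + s)) ^ 2 ≤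
      3 * K ^ 2 * (T ^ 4 * G ^ 2 + T ^ 4 * D ^ 2 + s ^ 2) := by
    have : 0 ≤ K ^ 2 * ((T ^ 2 * G - T ^ 2 * D) ^ 2 + (T ^ 2 * G - s) ^ 2
        + (T ^ 2 * D - s) ^ 2) := by positivity
    linarith
  have hT4 : Q * T ^ 4 ≤ T / 100 := by
    have h1 : T ^ 3 ≤ 1 := pow_le_one₀ hT.le hT1
    have h2 : Q * T * T ^ 3 ≤ 1 / 100 * T ^ 3 := by gcongr
    have h3 : T ^ 3 ≤ T := by nlinarith [mul_nonneg hT.le hT.le]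
    nlinarith
  have hT4' : Q * T ^ 4 ≤ 1 / 100 := by linarith
  have h1 : G * R ≤
      T / 100 * (3 / 2 * G ^ 2 + 1 / 2 * D ^ 2) + (T / 4 * G ^ 2 + Q / T * s ^ 2) := by
    have h2 : G * R ≤ G * (K * (T ^ 2 * (G + D) + s)) := by gcongr
    have h3 : K * T ^ 2 * (G ^ 2 + G * D) ≤ T / 100 * (G ^ 2 + G * D) := by gcongr
    have h4 : T / 100 * (G * D) ≤ T / 100 * (1 / 2 * (G ^ 2 + D ^ 2)) :=
      mul_le_mul_of_nonneg_left (by linarith [two_mul_le_add_sq G D]) (by positivity)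
    -- Young's inequality at scale T: the part in G is absorbed by the descent term, at the price of
    -- the factor 1/T on s².
    have h5 : K * (G * s) ≤ T / 4 * G ^ 2 + K ^ 2 / T * s ^ 2 := by
      have : T / 4 * G ^ 2 + K ^ 2 / T * s ^ 2 - K * (G * s) = (T / 2 * G - K * s) ^ 2 / T := by
        field_simp; ring
      have : 0 ≤ (T / 2 * G - K * s) ^ 2 / T := by positivity
      linarith
    have h6 : K ^ 2 / T * s ^ 2 ≤ Q / T * s ^ 2 := by gcongr
    linarith
  have h2 : L * (T * b * G + R) ^ 2 ≤
      2 * (T / 100) * G ^ 2 + 6 * (T / 100 * G ^ 2 + 1 / 100 * D ^ 2 + Q * s ^ 2) := by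
    have e1 : (T * b * G + R) ^ 2 ≤ 2 * (T * b * G) ^ 2 + 2 * R ^ 2 := by
      nlinarith [sq_nonneg (T * b * G - R)]
    have e2 : R ^ 2 ≤ (K * (T ^ 2 * (G + D) + s)) ^ 2 := by gcongr
    have e3 : L * (T * b * G + R) ^ 2 ≤ L * (2 * (T * b * G) ^ 2 +
        2 * (3 * K ^ 2 * (T ^ 4 * G ^ 2 + T ^ 4 * D ^ 2 + s ^ 2))) := by
      gcongr; linarith
    have e4 : L * b ^ 2 * (T ^ 2 * G ^ 2) ≤ Q * (T ^ 2 * G ^ 2) := by gcongr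
    have e5 : Q * T * (T * G ^ 2) ≤ 1 / 100 * (T * G ^ 2) := by gcongr
    have e6 : L * K ^ 2 * (T ^ 4 * G ^ 2 + T ^ 4 * D ^ 2 + s ^ 2) ≤
        Q * (T ^ 4 * G ^ 2 + T ^ 4 * D ^ 2 + s ^ 2) := by gcongr
    have e7 : Q * T ^ 4 * G ^ 2 ≤ T / 100 * G ^ 2 := by gcongr
    have e8 : Q * T ^ 4 * D ^ 2 ≤ 1 / 100 * D ^ 2 := by gcongr
    linarith
  have h3 : D' ^ 2 ≤ 3 * ((26 / 100) ^ 2 * D ^ 2 + T / 100 * G ^ 2 + Q * s ^ 2) := by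
    -- 26/100 = 1/4 + 1/100; after squaring three terms, 3 · (26/100)² < 1 still leaves room for the
    -- decrease in D².
    have e1 : D' ≤ 26 / 100 * D + K * T ^ 2 * G + K * s := by
      have : K * T ^ 2 * D ≤ 1 / 100 * D := by
        have : K * T ^ 2 ≤ 1 / 100 := by linarith
        gcongr
      linarith
    have e2 : D' ^ 2 ≤ (26 / 100 * D + K * T ^ 2 * G + K * s) ^ 2 := by gcongr
    have e3 : (26 / 100 * D + K * T ^ 2 * G + K * s) ^ 2 ≤
        3 * ((26 / 100 * D) ^ 2 + (K * T ^ 2 * G) ^ 2 + (K * s) ^ 2) := by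
      nlinarith [sq_nonneg (26 / 100 * D - K * T ^ 2 * G), sq_nonneg (26 / 100 * D - K * s),
        sq_nonneg (K * T ^ 2 * G - K * s)]
    have e4 : K ^ 2 * (T ^ 4 * G ^ 2) ≤ Q * (T ^ 4 * G ^ 2) := by gcongr
    have e5 : Q * T ^ 4 * G ^ 2 ≤ T / 100 * G ^ 2 := by gcongr
    have e6 : K ^ 2 * s ^ 2 ≤ Q * s ^ 2 := by gcongr
    linarith
  have h4 : T * 1 * G ^ 2 ≤ T * b * G ^ 2 := by gcongr
  have h5 : T / 100 * (1 / 2 * D ^ 2) ≤ 1 / 100 * (1 / 2 * D ^ 2) := by gcongr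
  have h6 : 0 ≤ T * G ^ 2 := by positivity
  have h7 : 0 ≤ D ^ 2 := by positivity
  linarith

/-! ### Doob's maximal inequality in a Hilbert space -/

section Maximal

variable {F : Type*} [NormedAddCommGroup F]

/-- The running maximum of the norms of the partial sums of a sequence. -/
noncomputable def maxNormPartialSum (v : ℕ → F) : ℕ → ℝ
  | 0 => 0
  | n + 1 => max (maxNormPartialSum v n) ‖∑ l ∈ Finset.range (n + 1), v l‖

theorem maxNormPartialSum_mono (v : ℕ → F) : Monotone (maxNormPartialSum v) :=
  monotone_nat_of_le_succ fun _ => le_max_left _ _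

theorem maxNormPartialSum_nonneg (v : ℕ → F) (n : ℕ) : 0 ≤ maxNormPartialSum v n :=
  maxNormPartialSum_mono v (Nat.zero_le n)

theorem norm_sum_range_le_maxNormPartialSum (v : ℕ → F) {i n : ℕ} (h : i ≤ n) :
    ‖∑ l ∈ Finset.range i, v l‖ ≤ maxNormPartialSum v n := by
  refine le_trans ?_ (maxNormPartialSum_mono v h)
  cases i with
  | zero => simp [maxNormPartialSum]
  | succ i => exact le_max_right _ _

theorem stronglyMeasurable_maxNormPartialSum {Ω : Type*} {m : MeasurableSpace Ω}
    {v : ℕ → Ω → F} {n : ℕ} (hv : ∀ l < n, StronglyMeasurable (v l)) :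
    StronglyMeasurable fun ω => maxNormPartialSum (fun l => v l ω) n := by
  induction n with
  | zero => exact stronglyMeasurable_const
  | succ n ih =>
    have h1 := ih fun l hl => hv l (by omega)
    have h2 : StronglyMeasurable fun ω => ∑ l ∈ Finset.range (n + 1), v l ω :=
      Finset.stronglyMeasurable_fun_sum _ fun l hl => hv l (Finset.mem_range.1 hl)
    exact h1.sup h2.norm

variable [InnerProductSpace ℝ F]

/-- The predictable multiplier in the pathwise form of Doob's `L²` inequality. -/
noncomputable def doobMultiplier (v : ℕ → F) (k : ℕ) : F :=
  (maxNormPartialSum v k * ‖∑ l ∈ Finset.range k, v l‖⁻¹) • ∑ l ∈ Finset.range k, v l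

theorem norm_doobMultiplier_le (v : ℕ → F) (k : ℕ) :
    ‖doobMultiplier v k‖ ≤ maxNormPartialSum v k := by
  have h0 := maxNormPartialSum_nonneg v k
  rw [doobMultiplier, norm_smul, Real.norm_of_nonneg (by positivity), mul_assoc]
  exact mul_le_of_le_one_right h0 inv_mul_le_one

/-- Convexity of the norm: S/‖S‖ is a subgradient at S. For S = 0 the convention 0⁻¹ = 0 gives the
subgradient 0. -/
theorem inner_doobMultiplier_le (v : ℕ → F) (k : ℕ) :
    inner ℝ (doobMultiplier v k) (v k) ≤ maxNormPartialSum v k *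
      (‖∑ l ∈ Finset.range (k + 1), v l‖ - ‖∑ l ∈ Finset.range k, v l‖) := by
  rw [Finset.sum_range_succ]
  have h0 := maxNormPartialSum_nonneg v k
  unfold doobMultiplier
  generalize maxNormPartialSum v k = M at *
  generalize ∑ l ∈ Finset.range k, v l = S
  rw [mul_smul, real_inner_smul_left]
  refine mul_le_mul_of_nonneg_left ?_ h0
  have h1 : inner ℝ (‖S‖⁻¹ • S) (S + v k) ≤ ‖S + v k‖ := by
    refine (real_inner_le_norm _ _).trans ?_
    refine mul_le_of_le_one_left (norm_nonneg _) ?_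
    rw [norm_smul, norm_inv, norm_norm]
    exact inv_mul_le_one
  have h2 : inner ℝ (‖S‖⁻¹ • S) S = ‖S‖ := by
    rw [real_inner_smul_left, real_inner_self_eq_norm_sq, sq, ← mul_assoc]
    rcases eq_or_ne ‖S‖ 0 with h | h
    · simp [h]
    · rw [inv_mul_cancel₀ h, one_mul]
  rw [inner_add_right, h2] at h1
  linarith

/-- Pathwise form of Doob's `L²` maximal inequality. -/
theorem maxNormPartialSum_sq_le (v : ℕ → F) (n : ℕ) :
    maxNormPartialSum v n ^ 2 ≤ 4 * ‖∑ l ∈ Finset.range n, v l‖ ^ 2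
      - 4 * ∑ k ∈ Finset.range n, inner ℝ (doobMultiplier v k) (v k) := by
  have key : 2 * ∑ k ∈ Finset.range n, inner ℝ (doobMultiplier v k) (v k) ≤
      2 * maxNormPartialSum v n * ‖∑ l ∈ Finset.range n, v l‖ - maxNormPartialSum v n ^ 2 := by
    induction n with
    | zero => simp [maxNormPartialSum]
    | succ n ih =>
      rw [Finset.sum_range_succ]
      have h1 := inner_doobMultiplier_le v n
      have h2 : 2 * maxNormPartialSum v n * ‖∑ l ∈ Finset.range (n + 1), v l‖
            - maxNormPartialSum v n ^ 2 ≤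
          2 * maxNormPartialSum v (n + 1) * ‖∑ l ∈ Finset.range (n + 1), v l‖
            - maxNormPartialSum v (n + 1) ^ 2 := by
        simp only [maxNormPartialSum]
        rcases max_cases (maxNormPartialSum v n) ‖∑ l ∈ Finset.range (n + 1), v l‖ with h | h
        -- If the maximum is unchanged, both sides agree; otherwise they differ by (M_n -
        -- ‖S_{n+1}‖)².
        · rw [h.1]
        · rw [h.1]
          nlinarith [sq_nonneg (maxNormPartialSum v n - ‖∑ l ∈ Finset.range (n + 1), v l‖)]
      nlinarith
  -- Complete the square: 2M‖S‖ ≤ M²/2 + 2‖S‖².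
  nlinarith [sq_nonneg (maxNormPartialSum v n - 2 * ‖∑ l ∈ Finset.range n, v l‖)]

theorem stronglyMeasurable_doobMultiplier {Ω : Type*} {m : MeasurableSpace Ω}
    {v : ℕ → Ω → F} {n : ℕ} (hv : ∀ l < n, StronglyMeasurable (v l)) :
    StronglyMeasurable fun ω => doobMultiplier (fun l => v l ω) n := by
  have h2 : StronglyMeasurable fun ω => ∑ l ∈ Finset.range n, v l ω :=
    Finset.stronglyMeasurable_fun_sum _ fun l hl => hv l (Finset.mem_range.1 hl)
  exact ((stronglyMeasurable_maxNormPartialSum hv).mul h2.norm.inv₀).smul h2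

variable {Ω : Type*} {mΩ : MeasurableSpace Ω} {μ : Measure Ω}

theorem MeasureTheory.MemLp.integrable_inner {h v : Ω → F} (hh : MemLp h 2 μ)
    (hv : MemLp v 2 μ) : Integrable (fun ω => inner ℝ (h ω) (v ω)) μ :=
  (hh.norm.integrable_mul hv.norm).mono' (hh.1.inner hv.1)
    (ae_of_all _ fun ω => norm_inner_le_norm (h ω) (v ω))

/-- The `m`-measurable factor can be pulled out of the conditional expectation. This kills both the
cross terms in E‖S_n‖² and the multiplier terms in the pathwise Doob inequality. -/
theorem integral_inner_eq_zero_of_condExp_eq_zero [CompleteSpace F] [IsProbabilityMeasure μ]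
    {m : MeasurableSpace Ω} (hm : m ≤ mΩ) {h v : Ω → F} (hmeas : StronglyMeasurable[m] h)
    (hh : MemLp h 2 μ) (hv : MemLp v 2 μ) (hcond : μ[v | m] =ᵐ[μ] 0) :
    ∫ ω, inner ℝ (h ω) (v ω) ∂μ = 0 := by
  have h1 := condExp_bilin_of_stronglyMeasurable_left (μ := μ) (innerSL ℝ) hmeas
    (hh.integrable_inner hv) (hv.integrable (by norm_num))
  have h2 := integral_condExp hm (μ := μ) (f := fun ω => inner ℝ (h ω) (v ω))
  rw [← h2]
  refine integral_eq_zero_of_ae ?_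
  filter_upwards [h1, hcond] with ω h3 h4
  refine h3.trans ?_
  simp [h4]

/-- Doob's `L²` maximal inequality for sums of vector valued martingale differences. -/
theorem integral_maxNormPartialSum_sq_le [CompleteSpace F] [IsProbabilityMeasure μ]
    {m : ℕ → MeasurableSpace Ω} (hm : ∀ k, m k ≤ mΩ) {v : ℕ → Ω → F}
    (hmeas : ∀ l k, l < k → StronglyMeasurable[m k] (v l)) (hv : ∀ k, MemLp (v k) 2 μ)
    (hcond : ∀ k, μ[v k | m k] =ᵐ[μ] 0) (n : ℕ) :
    Integrable (fun ω => maxNormPartialSum (fun l => v l ω) n ^ 2) μ ∧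
    ∫ ω, maxNormPartialSum (fun l => v l ω) n ^ 2 ∂μ ≤
      4 * ∑ k ∈ Finset.range n, ∫ ω, ‖v k ω‖ ^ 2 ∂μ := by
  have hS : ∀ n, MemLp (fun ω => ∑ l ∈ Finset.range n, v l ω) 2 μ := fun n =>
    memLp_finsetSum _ fun l _ => hv l
  have hSmeas : ∀ n, StronglyMeasurable[m n] fun ω => ∑ l ∈ Finset.range n, v l ω := fun n =>
    Finset.stronglyMeasurable_fun_sum _ fun l hl => hmeas l n (Finset.mem_range.1 hl)
  have hM : ∀ n, MemLp (fun ω => maxNormPartialSum (fun l => v l ω) n) 2 μ := by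
    intro n
    induction n with
    | zero => exact memLp_const 0
    | succ n ih => exact ih.sup (hS (n + 1)).norm
  have hd : ∀ n, MemLp (fun ω => doobMultiplier (fun l => v l ω) n) 2 μ := fun n =>
    (hM n).of_le ((stronglyMeasurable_doobMultiplier (m := m n) fun l hl =>
      hmeas l n hl).mono (hm n)).aestronglyMeasurable
      (ae_of_all _ fun ω => (norm_doobMultiplier_le _ n).trans (le_abs_self _))
  have hSsq : ∀ n, ∫ ω, ‖∑ l ∈ Finset.range n, v l ω‖ ^ 2 ∂μ =
      ∑ k ∈ Finset.range n, ∫ ω, ‖v k ω‖ ^ 2 ∂μ := by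
    intro n
    induction n with
    | zero => simp
    | succ n ih =>
      have h1 : ∀ ω, ‖∑ l ∈ Finset.range (n + 1), v l ω‖ ^ 2 =
          ‖∑ l ∈ Finset.range n, v l ω‖ ^ 2 +
            2 * inner ℝ (∑ l ∈ Finset.range n, v l ω) (v n ω) + ‖v n ω‖ ^ 2 := fun ω => by
        rw [Finset.sum_range_succ, norm_add_sq_real]
      simp_rw [h1]
      have i1 := (hS n).norm.integrable_sq
      have i2 := ((hS n).integrable_inner (hv n)).const_mul 2
      have i3 := (hv n).norm.integrable_sq
      have i4 : Integrable (fun ω => ‖∑ l ∈ Finset.range n, v l ω‖ ^ 2 +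
          2 * inner ℝ (∑ l ∈ Finset.range n, v l ω) (v n ω)) μ := i1.add i2
      rw [integral_add i4 i3, integral_add i1 i2, integral_const_mul,
        integral_inner_eq_zero_of_condExp_eq_zero (hm n) (hSmeas n) (hS n) (hv n) (hcond n), ih,
        Finset.sum_range_succ]
      ring
  refine ⟨(hM n).integrable_sq, ?_⟩
  have i1 := ((hS n).norm.integrable_sq).const_mul 4
  have i2 : Integrable (fun ω => ∑ k ∈ Finset.range n,
      inner ℝ (doobMultiplier (fun l => v l ω) k) (v k ω)) μ :=
    integrable_finsetSum _ fun k _ => (hd k).integrable_inner (hv k)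
  calc _ ≤ ∫ ω, (4 * ‖∑ l ∈ Finset.range n, v l ω‖ ^ 2 - 4 * ∑ k ∈ Finset.range n,
        inner ℝ (doobMultiplier (fun l => v l ω) k) (v k ω)) ∂μ :=
        integral_mono (hM n).integrable_sq (i1.sub (i2.const_mul 4))
          fun ω => maxNormPartialSum_sq_le (fun l => v l ω) n
    _ = _ := by
        rw [integral_sub i1 (i2.const_mul 4), integral_const_mul, integral_const_mul, hSsq,
          integral_finsetSum _ fun k _ => (hd k).integrable_inner (hv k)]
        rw [Finset.sum_eq_zero (s := Finset.range n) (f := fun k =>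
          ∫ ω, inner ℝ (doobMultiplier (fun l => v l ω) k) (v k ω) ∂μ)]
        · ring
        · intro k _
          exact integral_inner_eq_zero_of_condExp_eq_zero (hm k)
            (stronglyMeasurable_doobMultiplier (m := m k) fun l hl => hmeas l k hl) (hd k) (hv k)
            (hcond k)

theorem ae_summable_of_summable_integral {X : ℕ → Ω → ℝ} (hX : ∀ j ω, 0 ≤ X j ω)
    (hXint : ∀ j, Integrable (X j) μ) (hsum : Summable fun j => ∫ ω, X j ω ∂μ) :
    ∀ᵐ ω ∂μ, Summable fun j => X j ω := by
  have h := summable_norm_of_tsum_eLpNorm_ne_top (μ := μ) le_rfl (fun j => (hXint j).1) (by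
    have h1 : ∀ j, eLpNorm (X j) 1 μ = ENNReal.ofReal (∫ ω, X j ω ∂μ) := fun j => by
      rw [eLpNorm_one_eq_lintegral_enorm, ofReal_integral_eq_lintegral_ofReal (hXint j)
        (ae_of_all _ (hX j))]
      exact lintegral_congr fun ω => Real.enorm_of_nonneg (hX j ω)
    simp_rw [h1]
    rw [← ENNReal.ofReal_tsum_of_nonneg (fun j => integral_nonneg (hX j)) hsum]
    exact ENNReal.ofReal_ne_top)
  filter_upwards [h] with ω hω
  exact hω.of_norm

end Maximal

/-! ### Splitting the step sizes into blocks -/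

/-- Any divergent series of positive, vanishing step sizes can be split into consecutive blocks of
total length comparable to `τ`, after discarding finitely many terms. -/
theorem exists_blocks {α : ℕ → ℝ} (hαpos : ∀ k, 1 ≤ k → 0 < α k)
    (hαsum : Tendsto (fun n : ℕ => ∑ k ∈ Finset.Icc 1 n, α k) atTop atTop)
    (hαlim : Tendsto α atTop (𝓝 0)) {τ δ : ℝ} (hτ : 0 < τ) (hδ : 0 < δ) :
    ∃ m : ℕ → ℕ, StrictMono m ∧ 1 ≤ m 0 ∧ (∀ k, m 0 ≤ k → α k ≤ δ) ∧
      (∀ j, τ / 2 ≤ ∑ k ∈ Finset.Ico (m j) (m (j + 1)), α k) ∧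
      (∀ j, ∑ k ∈ Finset.Ico (m j) (m (j + 1)), α k ≤ 2 * τ) ∧
      ∃ c : ℝ, 0 < c ∧ ∀ j k, m j ≤ k → c * ((j : ℝ) + 1) ≤ ∑ i ∈ Finset.Icc 1 k, α i := by
  obtain ⟨N₀, hN₀⟩ := eventually_atTop.1
    (hαlim.eventually_lt_const (lt_min hδ (half_pos hτ)))
  set N := max N₀ 1 with hN
  have hN1 : 1 ≤ N := le_max_right _ _
  have hsmall : ∀ k, N ≤ k → α k < min δ (τ / 2) := fun k hk =>
    hN₀ k ((le_max_left _ _).trans hk)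
  set S : ℕ → ℝ := fun n => ∑ k ∈ Finset.Ico N n, α k with hS
  have hsub : ∀ {a b : ℕ}, N ≤ a → a ≤ b → S b = S a + ∑ k ∈ Finset.Ico a b, α k :=
    fun ha hb => (Finset.sum_Ico_consecutive α ha hb).symm
  have hIco0 : ∀ {a b : ℕ}, 1 ≤ a → 0 ≤ ∑ k ∈ Finset.Ico a b, α k := fun ha =>
    Finset.sum_nonneg fun k hk => (hαpos k (ha.trans (Finset.mem_Ico.1 hk).1)).le
  have hex : ∀ j : ℕ, ∃ n, N ≤ n ∧ (j : ℝ) * τ ≤ S n := by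
    intro j
    obtain ⟨n, hn, hnN⟩ := ((hαsum.eventually_ge_atTop
      ((j : ℝ) * τ + ∑ k ∈ Finset.Ico 1 N, α k)).and (eventually_ge_atTop N)).exists
    refine ⟨n + 1, by omega, ?_⟩
    have h1 : Finset.Icc 1 n = Finset.Ico 1 (n + 1) := by ext; simp
    have h2 := Finset.sum_Ico_consecutive α hN1 (by omega : N ≤ n + 1)
    rw [h1, ← h2] at hn
    simp only [hS]; linarith
  classical
  -- Block j starts when the sum from N first reaches jτ. Single steps are below τ/2, so the
  -- overshoot is at most τ/2 and block lengths lie between τ/2 and 3τ/2.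
  set m : ℕ → ℕ := fun j => Nat.find (hex j) with hm
  have hmN : ∀ j, N ≤ m j := fun j => (Nat.find_spec (hex j)).1
  have hmlow : ∀ j : ℕ, (j : ℝ) * τ ≤ S (m j) := fun j => (Nat.find_spec (hex j)).2
  have hmup : ∀ j : ℕ, S (m j) ≤ (j : ℝ) * τ + τ / 2 := by
    intro j
    rcases (hmN j).eq_or_lt with h | h
    · rw [← h]
      simp only [hS, Finset.Ico_self, Finset.sum_empty]
      positivity
    · obtain ⟨n, hn⟩ : ∃ n, m j = n + 1 := ⟨m j - 1, by omega⟩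
      have hlt : n < m j := by omega
      have h1 := Nat.find_min (hex j) hlt
      have hNn : N ≤ n := by omega
      have h2 : S n < (j : ℝ) * τ := by
        by_contra hcon
        exact h1 ⟨hNn, not_lt.1 hcon⟩
      have h3 : S (n + 1) = S n + α n := Finset.sum_Ico_succ_top hNn α
      have h4 := (hsmall n hNn).le.trans (min_le_right _ _)
      rw [hn, h3]; linarith
  have hmono : StrictMono m := by
    refine strictMono_nat_of_lt_succ fun j => ?_
    by_contra hcon
    have h1 := hsub (hmN (j + 1)) (not_lt.1 hcon)
    have h2 := hIco0 (b := m j) (hN1.trans (hmN (j + 1)))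
    have h3 := hmup j
    have h4 := hmlow (j + 1)
    push_cast at h4
    linarith
  have hblock : ∀ j, ∑ k ∈ Finset.Ico (m j) (m (j + 1)), α k = S (m (j + 1)) - S (m j) := by
    intro j
    have := hsub (hmN j) (hmono.monotone (Nat.le_succ j))
    linarith
  refine ⟨m, hmono, hN1.trans (hmN 0), fun k hk =>
    (hsmall k ((hmN 0).trans hk)).le.trans (min_le_left _ _), fun j => ?_, fun j => ?_, ?_⟩
  · have h1 := hmup j
    have h2 := hmlow (j + 1)
    push_cast at h2
    rw [hblock]; linarith
  · have h1 := hmlow j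
    have h2 := hmup (j + 1)
    push_cast at h2
    rw [hblock]; linarith
  · have hα1 := hαpos 1 le_rfl
    -- The sum is at least α 1 and at least jτ; averaging the two bounds also covers j = 0.
    refine ⟨min (α 1) τ / 2, by positivity, fun j k hk => ?_⟩
    have hnn : ∀ i ∈ Finset.Icc 1 k, 0 ≤ α i := fun i hi => (hαpos i (Finset.mem_Icc.1 hi).1).le
    have hk1 : 1 ≤ k := hN1.trans ((hmN j).trans hk)
    have h1 : α 1 ≤ ∑ i ∈ Finset.Icc 1 k, α i :=
      Finset.single_le_sum hnn (Finset.mem_Icc.2 ⟨le_rfl, hk1⟩)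
    have h2 : S (m j) ≤ ∑ i ∈ Finset.Icc 1 k, α i := by
      refine Finset.sum_le_sum_of_subset_of_nonneg (fun i hi => ?_) fun i hi _ => hnn i hi
      have := Finset.mem_Ico.1 hi
      exact Finset.mem_Icc.2 ⟨by omega, by omega⟩
    have h3 := hmlow j
    have h4 : (j : ℝ) * min (α 1) τ ≤ j * τ := by gcongr; exact min_le_right _ _
    have h5 := min_le_left (α 1) τ
    linarith

/-- Every index beyond the first block boundary lies in some block, and the block index tends to
infinity. -/
theorem exists_block_index {m : ℕ → ℕ} (hm : StrictMono m) :
    ∃ J : ℕ → ℕ, Tendsto J atTop atTop ∧ ∀ k, m 0 ≤ k → m (J k) ≤ k ∧ k ≤ m (J k + 1) := by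
  have h : ∀ k, ∃ j, m 0 ≤ k → m j ≤ k ∧ k < m (j + 1) := by
    intro k
    refine ⟨Nat.findGreatest (fun j => m j ≤ k) k, fun hk => ⟨?_, ?_⟩⟩
    · exact Nat.findGreatest_spec (P := fun j => m j ≤ k) (Nat.zero_le k) hk
    · by_contra hcon
      have h1 : m (Nat.findGreatest (fun j => m j ≤ k) k + 1) ≤ k := not_lt.1 hcon
      have h2 := Nat.le_findGreatest (P := fun j => m j ≤ k) (hm.le_apply.trans h1) h1
      omega
  choose J hJ using h
  refine ⟨J, ?_, fun k hk => ⟨(hJ k hk).1, (hJ k hk).2.le⟩⟩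
  refine tendsto_atTop.2 fun b => ?_
  filter_upwards [eventually_ge_atTop (m b), eventually_ge_atTop (m 0)] with k hk hk0
  by_contra hcon
  have h1 := (hJ k hk0).2
  have h2 : m (J k + 1) ≤ m b := hm.monotone (by omega)
  omega

theorem summable_sum_blocks {m : ℕ → ℕ} (hm : StrictMono m) {w : ℕ → ℝ} (hw0 : ∀ k, 0 ≤ w k)
    (hw : Summable w) : Summable fun j => ∑ k ∈ Finset.Ico (m j) (m (j + 1)), w k := by
  refine summable_of_sum_range_le (c := ∑' k, w k)
    (fun j => Finset.sum_nonneg fun k _ => hw0 k) fun n => ?_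
  have h : ∑ j ∈ Finset.range n, ∑ k ∈ Finset.Ico (m j) (m (j + 1)), w k =
      ∑ k ∈ Finset.Ico (m 0) (m n), w k := by
    induction n with
    | zero => simp
    | succ n ih =>
      rw [Finset.sum_range_succ, ih]
      exact Finset.sum_Ico_consecutive w (hm.monotone (Nat.zero_le n))
        (hm.monotone (Nat.le_succ n))
  rw [h]
  exact hw.sum_le_tsum _ fun k _ => hw0 k

/-- The partial sums are at least α 1 > 0, so the weights in the summable series are bounded away
from 0. -/
theorem tendsto_stepSize_zero {α : ℕ → ℝ} (hαpos : ∀ k, 1 ≤ k → 0 < α k) {r : ℝ} (hr : 0 ≤ r)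
    (hαsq : Summable fun k : ℕ =>
      α (k + 1) ^ 2 * (∑ i ∈ Finset.Icc 1 (k + 1), α i) ^ (2 * r)) :
    Tendsto α atTop (𝓝 0) := by
  have hα1 := hαpos 1 le_rfl
  rw [← tendsto_add_atTop_iff_nat 1]
  have hc : 0 < α 1 ^ (2 * r) := Real.rpow_pos_of_pos hα1 _
  have h1 : Tendsto (fun k => α (k + 1) ^ 2) atTop (𝓝 0) := by
    have h2 := hαsq.tendsto_atTop_zero.mul_const (α 1 ^ (2 * r))⁻¹
    rw [zero_mul] at h2
    refine squeeze_zero (fun k => sq_nonneg _) (fun k => ?_) h2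
    have h3 : α 1 ≤ ∑ i ∈ Finset.Icc 1 (k + 1), α i :=
      Finset.single_le_sum (f := α) (fun i hi => (hαpos i (Finset.mem_Icc.1 hi).1).le)
        (Finset.mem_Icc.2 ⟨le_rfl, by omega⟩)
    rw [← div_eq_mul_inv, le_div_iff₀ hc]
    gcongr
  have h2 := h1.sqrt
  rw [Real.sqrt_zero] at h2
  exact h2.congr fun k => Real.sqrt_sq (hαpos _ (by omega)).le

/-! ### Pathwise convergence -/

/-- Convergence of a single trajectory of the momentum method, provided that the maximal partial
sums of the noise over blocks of size `τ` are square summable with weights `(j + 1) ^ p`, `p > 1`.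
The block size depends on `f` and on the momentum parameters only. -/
theorem exists_blockSize_dichotomy {d : ℕ} {f : EuclideanSpace ℝ (Fin d) → ℝ}
    (hf : SmoothBoundedBelow f) (hloj : ∀ xs ∈ critSet f, LojasiewiczAt f xs)
    {lam ν : ℝ} (hlam0 : 0 ≤ lam) (hlam1 : lam < 1) (hν : 0 ≤ ν) :
    ∃ τ δ : ℝ, 0 < τ ∧ 0 < δ ∧ ∀ (α : ℕ → ℝ) (m : ℕ → ℕ) (x e : ℕ → EuclideanSpace ℝ (Fin d))
      (s : ℕ → ℝ) (p : ℝ), 1 < p → StrictMono m → 1 ≤ m 0 → (∀ k, m 0 ≤ k → 0 < α k) →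
      (∀ k, m 0 ≤ k → α k ≤ δ) →
      (∀ j, τ / 2 ≤ ∑ k ∈ Finset.Ico (m j) (m (j + 1)), α k) →
      (∀ j, ∑ k ∈ Finset.Ico (m j) (m (j + 1)), α k ≤ 2 * τ) →
      (∀ k, 1 ≤ k → x (k + 1) = x k - α k • (∇ f (x k + ν • (x k - x (k - 1))) - e k)
        + lam • (x k - x (k - 1))) →
      (∀ j, ∀ i ≤ m (j + 1) - m j,
        ‖∑ l ∈ Finset.range i, α (m j + l) • e (m j + l)‖ ≤ s j) →
      (Summable fun j : ℕ => ((j : ℝ) + 1) ^ p * s j ^ 2) →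
      Tendsto (fun k => ‖x k‖) atTop atTop ∨ ∃ xs ∈ critSet f, Tendsto x atTop (𝓝 xs) := by
  obtain ⟨hdiff, hbdd, L, hLpos, hLip⟩ := hf
  have hh : 0 < 1 - lam := by linarith
  set b := (1 - lam)⁻¹ with hb
  have hb1 : 1 ≤ b := (one_le_inv₀ hh).2 (by linarith)
  have hb0 : 0 ≤ b := by linarith
  have hbl : (1 - lam) * b = 1 := mul_inv_cancel₀ hh.ne'
  -- The gradient is evaluated at x + ν v, which is z + (ν - λb) v, and |ν - λb| ≤ κ.
  set κ := ν + lam * b with hκ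
  have hκ0 : 0 ≤ κ := by positivity
  obtain ⟨K, T₀, hK1, hT₀, hblock⟩ := block_estimates (F := EuclideanSpace ℝ (Fin d))
    (L := L) L.coe_nonneg hκ0 hlam0 hlam1
  set Q := K ^ 2 + L * K ^ 2 + L * b ^ 2 with hQ
  have hQ0 : 0 < Q := by positivity
  obtain ⟨N, hN⟩ := exists_pow_lt_of_lt_one (by norm_num : (0 : ℝ) < 1 / 4) hlam1
  set τ := min (min T₀ 1) (1 / (100 * Q)) / 2 with hτ
  have hτ0 : 0 < τ := by positivity
  have hτT : 2 * τ ≤ T₀ := by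
    have := (min_le_left (min T₀ 1) (1 / (100 * Q))).trans (min_le_left _ _)
    rw [hτ]; linarith
  have hτ1 : 2 * τ ≤ 1 := by
    have := (min_le_left (min T₀ 1) (1 / (100 * Q))).trans (min_le_right _ _)
    rw [hτ]; linarith
  have hτQ : Q * (2 * τ) ≤ 1 / 100 := by
    have h1 : 2 * τ ≤ 1 / (100 * Q) := by
      have := min_le_right (min T₀ 1) (1 / (100 * Q))
      rw [hτ]; linarith
    rw [le_div_iff₀ (by positivity)] at h1
    linarith
  -- The first bound gives δ ≤ T² for blocks with T ≥ τ/2. The second forces at least N + 1 steps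
  -- per block, so momentum shrinks by λ^n ≤ 1/4.
  set δ := min ((τ / 2) ^ 2) (τ / (2 * (N + 1))) with hδ
  have hδ0 : 0 < δ := by positivity
  refine ⟨τ, δ, hτ0, hδ0, ?_⟩
  intro α m x e s p hp hm hm1 hαpos hαδ hlow hup hx hs hsum
  have hs0 : ∀ j, 0 ≤ s j := fun j => (norm_nonneg _).trans (hs j 0 (Nat.zero_le _))
  have hmj : ∀ j, m 0 ≤ m j := fun j => hm.monotone (Nat.zero_le j)
  set v : ℕ → EuclideanSpace ℝ (Fin d) := fun k => x k - x (k - 1) with hv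
  set z : ℕ → EuclideanSpace ℝ (Fin d) := fun k => x k + (lam * b) • v k with hz
  set g : ℕ → EuclideanSpace ℝ (Fin d) := fun k => ∇ f (x k + ν • v k) with hg
  have hvstep : ∀ k, 1 ≤ k → v (k + 1) = lam • v k - α k • (g k - e k) := by
    intro k hk
    simp only [hv, hg, Nat.add_sub_cancel]
    rw [hx k hk]
    module
  have hzstep : ∀ k, 1 ≤ k → z (k + 1) = z k - (α k * b) • (g k - e k) := by
    intro k hk
    have h1 := hvstep k hk
    have h2 : x (k + 1) = x k + v (k + 1) := by simp [hv]
    have h3 : z (k + 1) - (z k - (α k * b) • (g k - e k)) =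
        (1 - (1 - lam) * b) • (lam • v k - α k • (g k - e k)) := by
      simp only [hz]
      rw [h2, h1]
      module
    rw [hbl, sub_self, zero_smul] at h3
    exact sub_eq_zero.1 h3
  have hgdev : ∀ k l, ‖g k - ∇ f (z l)‖ ≤ L * (‖z k - z l‖ + κ * ‖v k‖) := by
    intro k l
    simp only [hg]
    rw [← dist_eq_norm]
    refine (hLip.dist_le_mul _ _).trans ?_
    gcongr
    rw [dist_eq_norm]
    have h1 : x k + ν • v k - z l = (z k - z l) + (ν - lam * b) • v k := by
      simp only [hz]; module
    rw [h1]
    refine (norm_add_le _ _).trans ?_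
    rw [norm_smul]
    gcongr
    rw [Real.norm_eq_abs, hκ]
    refine (abs_sub _ _).trans (le_of_eq ?_)
    rw [abs_of_nonneg hν, abs_of_nonneg (by positivity)]
  set n : ℕ → ℕ := fun j => m (j + 1) - m j with hn
  have hmn : ∀ j, m j + n j = m (j + 1) := fun j => by
    have : m j ≤ m (j + 1) := hm.monotone (Nat.le_succ j)
    simp only [hn]; omega
  set T : ℕ → ℝ := fun j => ∑ k ∈ Finset.Ico (m j) (m (j + 1)), α k with hT
  have hTsum : ∀ j, ∑ l ∈ Finset.range (n j), α (m j + l) = T j := fun j =>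
    (Finset.sum_Ico_eq_sum_range α (m j) (m (j + 1))).symm
  have hT0 : ∀ j, 0 < T j := fun j => (half_pos hτ0).trans_le (hlow j)
  have hnN : ∀ j, lam ^ n j ≤ 1 / 4 := by
    intro j
    have h1 : T j ≤ n j * δ := by
      rw [← hTsum]
      calc _ ≤ ∑ l ∈ Finset.range (n j), δ :=
            Finset.sum_le_sum fun l _ => hαδ _ ((hmj j).trans (Nat.le_add_right _ _))
        _ = n j * δ := by simp
    have h2 : (n j : ℝ) * δ ≤ n j * (τ / (2 * (N + 1))) := by
      gcongr; exact min_le_right _ _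
    have h3 : τ / 2 ≤ n j * (τ / (2 * (N + 1))) := (hlow j).trans (h1.trans h2)
    have h4 : (N : ℝ) + 1 ≤ n j := by
      rw [← mul_div_assoc, le_div_iff₀ (by positivity)] at h3
      have : ((N : ℝ) + 1) * τ ≤ n j * τ := by linarith
      exact le_of_mul_le_mul_right this hτ0
    have h5 : N ≤ n j := by
      have : (N : ℝ) ≤ n j := by linarith
      exact_mod_cast this
    exact (pow_le_pow_of_le_one hlam0 hlam1.le h5).trans hN.le
  have key := fun j => hblock (n j) (fun l => α (m j + l)) (fun l => g (m j + l))
    (fun l => e (m j + l)) (fun l => z (m j + l)) (fun l => v (m j + l)) (∇ f (z (m j))) δ (T j)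
    (s j) hδ0.le ((min_le_left _ _).trans (pow_le_pow_left₀ (half_pos hτ0).le (hlow j) 2))
    (hT0 j).le ((hup j).trans hτT)
    (fun l _ => (hαpos _ ((hmj j).trans (Nat.le_add_right _ _))).le)
    (fun l _ => hαδ _ ((hmj j).trans (Nat.le_add_right _ _))) (hTsum j) (hs j)
    (fun l _ => hzstep (m j + l) (by have := hmj j; omega))
    (fun l _ => hvstep (m j + l) (by have := hmj j; omega))
    (fun l _ => hgdev (m j + l) (m j))
  simp only [hmn, Nat.add_zero, ← hb] at key
  set C := max (2 * Q / τ + 9 * Q) K with hC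
  have hC0 : 0 < C := lt_max_of_lt_right (by linarith)
  set c := min (τ / 8) (1 / 8) with hc
  have hc0 : 0 < c := by positivity
  have hdec : ∀ j, f (z (m (j + 1))) + ‖v (m (j + 1))‖ ^ 2 ≤ f (z (m j)) + ‖v (m j)‖ ^ 2
      - c * (‖∇ f (z (m j))‖ ^ 2 + ‖v (m j)‖ ^ 2) + C * s j ^ 2 := by
    intro j
    obtain ⟨k1, k2, -, -⟩ := key j
    set γ := ∇ f (z (m j)) with hγ
    set R := z (m (j + 1)) - z (m j) + (T j * b) • γ with hR
    have hTb : 0 ≤ T j * b := mul_nonneg (hT0 j).le hb0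
    have hZ : z (m (j + 1)) - z (m j) = R - (T j * b) • γ := by rw [hR]; abel
    have h1 := le_add_inner_gradient_add_mul_norm_sq hdiff hLip (z (m j)) (z (m (j + 1)))
    have h2 : inner ℝ γ (z (m (j + 1)) - z (m j)) ≤ ‖γ‖ * ‖R‖ - T j * b * ‖γ‖ ^ 2 := by
      rw [hZ, inner_sub_right, real_inner_smul_right, real_inner_self_eq_norm_sq]
      linarith [real_inner_le_norm γ R]
    have h3 : ‖z (m (j + 1)) - z (m j)‖ ≤ T j * b * ‖γ‖ + ‖R‖ := by
      rw [hZ]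
      refine (norm_sub_le _ _).trans ?_
      rw [norm_smul, Real.norm_of_nonneg hTb]
      linarith
    have h4 : (L : ℝ) * ‖z (m (j + 1)) - z (m j)‖ ^ 2 ≤ L * (T j * b * ‖γ‖ + ‖R‖) ^ 2 := by
      gcongr
    have h5 := lyapunov_decrease_arith (f₀ := f (z (m j))) (f₁ := f (z (m (j + 1))))
      (G := ‖γ‖) (D := ‖v (m j)‖) (D' := ‖v (m (j + 1))‖) (R := ‖R‖) (s := s j) (T := T j)
      (b := b) (K := K) (L := L) (Q := Q) (norm_nonneg _) (norm_nonneg _) (norm_nonneg _)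
      (norm_nonneg _) (hT0 j) ((hup j).trans hτ1) hb1 hK1 L.coe_nonneg
      (by have : 0 ≤ (L : ℝ) * K ^ 2 + L * b ^ 2 := by positivity
          rw [hQ]; linarith)
      (by have : 0 ≤ K ^ 2 + (L : ℝ) * b ^ 2 := by positivity
          rw [hQ]; linarith)
      (by have : 0 ≤ K ^ 2 + (L : ℝ) * K ^ 2 := by positivity
          rw [hQ]; linarith)
      ((mul_le_mul_of_nonneg_left (hup j) hQ0.le).trans hτQ) k1
      (k2.trans (by gcongr; exact hnN j)) (by linarith)
    have h6 : c * ‖γ‖ ^ 2 ≤ T j / 4 * ‖γ‖ ^ 2 := by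
      gcongr
      have := hlow j
      linarith [min_le_left (τ / 8) (1 / 8)]
    have h7 : c * ‖v (m j)‖ ^ 2 ≤ 1 / 8 * ‖v (m j)‖ ^ 2 := by
      gcongr; exact min_le_right _ _
    have h8 : (Q / T j + 9 * Q) * s j ^ 2 ≤ C * s j ^ 2 := by
      gcongr
      refine le_trans ?_ (le_max_left _ _)
      have : Q / T j ≤ Q / (τ / 2) := by
        gcongr; exact hlow j
      have h9 : Q / (τ / 2) = 2 * Q / τ := by field_simp
      linarith
    linarith
  have hstep : ∀ j, ‖z (m (j + 1)) - z (m j)‖ ≤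
      C * (‖∇ f (z (m j))‖ + ‖v (m j)‖ + s j) := by
    intro j
    have h1 := (key j).2.2.1 (n j) le_rfl
    rw [hmn] at h1
    refine h1.trans ?_
    have := hs0 j
    gcongr
    exact le_max_right _ _
  obtain ⟨hlim, hdich⟩ := inexact_descent_dichotomy hdiff.continuous hLip.continuous hbdd hloj
    (Z := fun j => z (m j)) (D := fun j => ‖v (m j)‖) (fun j => norm_nonneg _) hs0 hp hc0 hC0
    hsum hdec hstep
  obtain ⟨J, hJ, hJm⟩ := exists_block_index hm
  -- Within a block, x moves away from the initial z by at most a multiple of ‖∇f(z)‖ + ‖v‖ + s,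
  -- which tends to 0.
  have hxz : Tendsto (fun k => x k - z (m (J k))) atTop (𝓝 0) := by
    refine squeeze_zero_norm' (a := fun k => (1 + lam * b) * K *
      (‖∇ f (z (m (J k)))‖ + ‖v (m (J k))‖ + s (J k))) ?_ ?_
    · filter_upwards [eventually_ge_atTop (m 0)] with k hk
      obtain ⟨hk1, hk2⟩ := hJm k hk
      have hle : k - m (J k) ≤ n (J k) := by simp only [hn]; omega
      have h1 := (key (J k)).2.2.1 _ hle
      have h2 := (key (J k)).2.2.2 _ hle
      rw [Nat.add_sub_cancel' hk1] at h1 h2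
      have h3 : x k - z (m (J k)) = (z k - z (m (J k))) - (lam * b) • v k := by
        simp only [hz]; module
      rw [h3]
      refine (norm_sub_le _ _).trans ?_
      have hlb : 0 ≤ lam * b := by positivity
      rw [norm_smul, Real.norm_of_nonneg hlb]
      have h4 := mul_le_mul_of_nonneg_left h2 hlb
      linarith
    · have := (hlim.comp hJ).const_mul ((1 + lam * b) * K)
      rwa [mul_zero] at this
  rcases hdich with h | ⟨xs, hxs, h⟩
  · left
    have h1 := (h.comp hJ).atTop_add hxz.norm.neg
    refine tendsto_atTop_mono (fun k => ?_) h1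
    have := norm_sub_norm_le (z (m (J k))) (x k)
    rw [norm_sub_rev] at this
    simp only [Function.comp]
    linarith
  · right
    refine ⟨xs, hxs, ?_⟩
    have := hxz.add (h.comp hJ)
    simpa using this

/-! ### Almost sure control of the noise and conclusion -/

/-- The noise of step `k` can be recovered from the iterates up to time `k + 1`. -/
theorem IsSGDM.stronglyMeasurable_noise {d : ℕ} {Ω : Type*} [MeasurableSpace Ω]
    {f : EuclideanSpace ℝ (Fin d) → ℝ} (hgc : Continuous (∇ f)) {α : ℕ → ℝ} {lam ν : ℝ}
    {x₀ : EuclideanSpace ℝ (Fin d)} {e x : ℕ → Ω → EuclideanSpace ℝ (Fin d)}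
    (h : IsSGDM f α lam ν x₀ e x) (hx : ∀ k, StronglyMeasurable (x k)) {k : ℕ} (hk : 1 ≤ k)
    (hα : α k ≠ 0) : StronglyMeasurable[Filtration.natural x hx (k + 1)] (e k) := by
  have hxm : ∀ i ≤ k + 1, StronglyMeasurable[Filtration.natural x hx (k + 1)] (x i) :=
    fun i hi => (Filtration.stronglyAdapted_natural hx i).mono ((Filtration.natural x hx).mono hi)
  have h1 := hxm (k + 1) le_rfl
  have h2 := hxm k (by omega)
  have h3 := hxm (k - 1) (by omega)
  have heq : e k = fun ω => (α k)⁻¹ • (x (k + 1) ω - x k ω - lam • (x k ω - x (k - 1) ω))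
      + ∇ f (x k ω + ν • (x k ω - x (k - 1) ω)) := by
    funext ω
    rw [h.step k hk ω]
    have : ∀ u w y : EuclideanSpace ℝ (Fin d),
        w = (α k)⁻¹ • (y - α k • (u - w) + lam • (x k ω - x (k - 1) ω) - y
          - lam • (x k ω - x (k - 1) ω)) + u := by
      intro u w y
      have h4 : y - α k • (u - w) + lam • (x k ω - x (k - 1) ω) - y
          - lam • (x k ω - x (k - 1) ω) = α k • (w - u) := by module
      rw [h4, smul_smul, inv_mul_cancel₀ hα, one_smul, sub_add_cancel]
    exact this _ _ _
  rw [heq]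
  exact (((h1.sub h2).sub ((h2.sub h3).const_smul lam)).const_smul (α k)⁻¹).add
    (hgc.comp_stronglyMeasurable (h2.add ((h2.sub h3).const_smul ν)))

theorem NoiseAssumption.integral_norm_sq_le {d : ℕ} {Ω : Type*} [MeasurableSpace Ω]
    {μ : Measure Ω} [IsProbabilityMeasure μ] {x : ℕ → Ω → EuclideanSpace ℝ (Fin d)}
    {hx : ∀ k, StronglyMeasurable (x k)} {e : ℕ → Ω → EuclideanSpace ℝ (Fin d)} {σ : ℝ}
    (h : NoiseAssumption μ x hx e σ) {k : ℕ} (hk : 1 ≤ k) :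
    ∫ ω, ‖e k ω‖ ^ 2 ∂μ ≤ σ ^ 2 := by
  rw [← integral_condExp ((Filtration.natural x hx).le k)]
  calc _ ≤ ∫ _, σ ^ 2 ∂μ :=
        integral_mono_ae integrable_condExp (integrable_const _) (h.condVar k hk)
    _ = σ ^ 2 := by simp

/-- Almost sure weighted square summability of the maximal partial sums of the noise over blocks. -/
theorem ae_summable_block_noise {d : ℕ} {Ω : Type*} [MeasurableSpace Ω] {μ : Measure Ω}
    [IsProbabilityMeasure μ] {f : EuclideanSpace ℝ (Fin d) → ℝ} (hgc : Continuous (∇ f))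
    {lam ν : ℝ} {α : ℕ → ℝ} (hαpos : ∀ k, 1 ≤ k → 0 < α k) {r : ℝ} (hr : 0 ≤ r)
    (hαsq : Summable fun k : ℕ =>
      α (k + 1) ^ 2 * (∑ i ∈ Finset.Icc 1 (k + 1), α i) ^ (2 * r))
    {x₀ : EuclideanSpace ℝ (Fin d)} {e x : ℕ → Ω → EuclideanSpace ℝ (Fin d)}
    {hx : ∀ k, StronglyMeasurable (x k)} (hsgdm : IsSGDM f α lam ν x₀ e x)
    {σ : ℝ} (hnoise : NoiseAssumption μ x hx e σ)
    {m : ℕ → ℕ} (hm : StrictMono m) (hm1 : 1 ≤ m 0) {c : ℝ} (hc : 0 < c)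
    (hS : ∀ j k, m j ≤ k → c * ((j : ℝ) + 1) ≤ ∑ i ∈ Finset.Icc 1 k, α i) :
    ∀ᵐ ω ∂μ, Summable fun j : ℕ => ((j : ℝ) + 1) ^ (2 * r) *
      maxNormPartialSum (fun l => α (m j + l) • e (m j + l) ω) (m (j + 1) - m j) ^ 2 := by
  have hmj : ∀ j, 1 ≤ m j := fun j => hm1.trans (hm.monotone (Nat.zero_le j))
  have hdoob := fun j => integral_maxNormPartialSum_sq_le (μ := μ)
    (m := fun l => Filtration.natural x hx (m j + l)) (fun l => (Filtration.natural x hx).le _)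
    (v := fun l ω => α (m j + l) • e (m j + l) ω)
    (fun l k hlk => by
      have h1 := hmj j
      -- The error e_{m j + l} is known only at time m j + l + 1, which is at most m j + k because l
      -- < k.
      have h2 := (hsgdm.stronglyMeasurable_noise hgc hx (by omega : 1 ≤ m j + l)
        (hαpos _ (by omega)).ne').mono
        ((Filtration.natural x hx).mono (by omega : m j + l + 1 ≤ m j + k))
      exact h2.const_smul (α (m j + l)))
    (fun l => (hnoise.memLp (m j + l) (by have := hmj j; omega)).const_smul (α (m j + l)))
    (fun l => by
      have h1 := condExp_smul (μ := μ) (α (m j + l)) (e (m j + l))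
        (Filtration.natural x hx (m j + l))
      have h2 := hnoise.condMean (m j + l) (by have := hmj j; omega)
      filter_upwards [h1, h2] with ω h3 h4
      refine h3.trans ?_
      simp [h4]) (m (j + 1) - m j)
  set w : ℕ → ℝ := fun k => α k ^ 2 * (∑ i ∈ Finset.Icc 1 k, α i) ^ (2 * r) with hw
  have hS0 : ∀ k, 0 ≤ ∑ i ∈ Finset.Icc 1 k, α i := fun k =>
    Finset.sum_nonneg fun i hi => (hαpos i (Finset.mem_Icc.1 hi).1).le
  have hw0 : ∀ k, 0 ≤ w k := fun k => mul_nonneg (sq_nonneg _) (Real.rpow_nonneg (hS0 k) _)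
  have hwsum : Summable w := (summable_nat_add_iff 1).1 hαsq
  refine ae_summable_of_summable_integral (fun j ω => by positivity)
    (fun j => (hdoob j).1.const_mul _) ?_
  refine ((summable_sum_blocks hm hw0 hwsum).mul_left
    (4 * σ ^ 2 * (c ^ (2 * r))⁻¹)).of_nonneg_of_le
    (fun j => integral_nonneg fun ω => by positivity) fun j => ?_
  have hcr : 0 < c ^ (2 * r) := Real.rpow_pos_of_pos hc _
  rw [integral_const_mul]
  calc _ ≤ ((j : ℝ) + 1) ^ (2 * r) * (4 * ∑ l ∈ Finset.range (m (j + 1) - m j),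
        α (m j + l) ^ 2 * σ ^ 2) := by
        gcongr
        refine (hdoob j).2.trans ?_
        gcongr with l
        simp_rw [norm_smul, mul_pow, Real.norm_eq_abs, sq_abs]
        rw [integral_const_mul]
        gcongr
        exact hnoise.integral_norm_sq_le (by have := hmj j; omega)
    _ = 4 * σ ^ 2 * ∑ k ∈ Finset.Ico (m j) (m (j + 1)), ((j : ℝ) + 1) ^ (2 * r) * α k ^ 2 := by
        rw [Finset.sum_Ico_eq_sum_range, ← Finset.sum_mul, ← Finset.mul_sum]
        ring
    _ ≤ 4 * σ ^ 2 * ∑ k ∈ Finset.Ico (m j) (m (j + 1)), (c ^ (2 * r))⁻¹ * w k := by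
        refine mul_le_mul_of_nonneg_left (Finset.sum_le_sum fun k hk => ?_) (by positivity)
        -- In block j, the weight (j+1)^(2r) is at most c^(-2r) times the 2r-th power of the sum of
        -- step sizes up to k.
        have h1 := hS j k (Finset.mem_Ico.1 hk).1
        have h2 := Real.rpow_le_rpow (by positivity) h1 (by positivity : 0 ≤ 2 * r)
        rw [Real.mul_rpow hc.le (by positivity)] at h2
        rw [inv_mul_eq_div, le_div_iff₀ hcr]
        simp only [hw]
        have h3 := mul_le_mul_of_nonneg_left h2 (sq_nonneg (α k))
        linarith
    _ = _ := by rw [← Finset.mul_sum]; ring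

theorem mainTheorem2 {d : ℕ} {Ω : Type*} [MeasurableSpace Ω] (μ : Measure Ω)
    [IsProbabilityMeasure μ]
    (f : EuclideanSpace ℝ (Fin d) → ℝ) (hf : SmoothBoundedBelow f)
    (hloj : ∀ xs ∈ critSet f, LojasiewiczAt f xs)
    (lam ν : ℝ) (hlam0 : 0 ≤ lam) (hlam1 : lam < 1) (hν : 0 ≤ ν)
    (α : ℕ → ℝ) (hαpos : ∀ k, 1 ≤ k → 0 < α k)
    (hαmono : ∀ k, 1 ≤ k → α (k + 1) ≤ α k)
    (hαsum : Tendsto (fun n : ℕ => ∑ k ∈ Finset.Icc 1 n, α k) atTop atTop)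
    (r : ℝ) (hr : 1 / 2 < r)
    (hαsq : Summable fun k : ℕ =>
      α (k + 1) ^ 2 * (∑ i ∈ Finset.Icc 1 (k + 1), α i) ^ (2 * r))
    (x₀ : EuclideanSpace ℝ (Fin d)) (e x : ℕ → Ω → EuclideanSpace ℝ (Fin d))
    (hx : ∀ k, StronglyMeasurable (x k))
    (hsgdm : IsSGDM f α lam ν x₀ e x)
    (σ : ℝ) (hnoise : NoiseAssumption μ x hx e σ) :
    ∀ᵐ ω ∂μ, Tendsto (fun k => ‖x k ω‖) atTop atTop ∨
      ∃ xs ∈ critSet f, Tendsto (fun k => x k ω) atTop (𝓝 xs) := by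
  have hgc : Continuous (∇ f) := by
    obtain ⟨L, -, hL⟩ := hf.lipschitz
    exact hL.continuous
  obtain ⟨τ, δ, hτ, hδ, H⟩ := exists_blockSize_dichotomy hf hloj hlam0 hlam1 hν
  obtain ⟨m, hm, hm1, hαδ, hlow, hup, c, hc, hS⟩ := exists_blocks hαpos hαsum
    (tendsto_stepSize_zero hαpos (by linarith) hαsq) hτ hδ
  filter_upwards [ae_summable_block_noise hgc hαpos (by linarith) hαsq hsgdm hnoise hm hm1 hc hS]
    with ω hω
  -- The exponent p = 2r exceeds 1 exactly because r > 1/2.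
  exact H α m (fun k => x k ω) (fun k => e k ω) _ (2 * r) (by linarith) hm hm1
    (fun k hk => hαpos k (hm1.trans hk)) hαδ hlow hup (fun k hk => hsgdm.step k hk ω)
    (fun j i hi => norm_sum_range_le_maxNormPartialSum
      (fun l => α (m j + l) • e (m j + l) ω) hi) hω
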